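/- Let $k$ be a field of characteristic $0$ and let $P$ be a locally finite poset. Let $A=kP$ be the incidence algebra of $P$ over $k$: its elements are the functions $a$ on pairs $i\le j$ of $P$ with values in $k$ (formal sums $\sum_{i\le j}a(i,j)E^{ij}$), with product $(ab)(i,l)=\sum_{i\le j\le l}a(i,j)\,b(j,l)$, so that $E^{ij}E^{jl}=E^{il}$. A formal deformation of $A$ is an associative $k[[\lambda]]$-bilinear product $F=m_A+\lambda F_1+\lambda^2F_2+\cdots$ on $A[[\lambda]]$, where $m_A$ is the product of $A$, the $F_n\colon A\times A\to A$ are $k$-bilinear and extended $\lambda$-linearly, and $F(1,a)=F(a,1)=a$ for all $a\in A$. Two deformations $F,F'$ are equivalent if there is a $k[[\lambda]]$-algebra isomorphism $f\colon(A[[\lambda]],F')\to(A[[\lambda]],F)$ of the form $f=\mathrm{id}_A+\lambda f_1+\lambda^2f_2+\cdots$ with $f_n\colon A\to A$ $k$-linear. Let $W=1+\lambda k[[\lambda]]$ be the multiplicative group of big Witt vectors, and let $H^2(P;W)$ be the second simplicial cohomology group of the nerve of $P$ with coefficients in the abelian group $W$ (so a $2$-cochain is a function $\omega=1+\sum_{n\ge1}\omega_n\lambda^n$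 of the triples $i\le j\le l$ in $P$ with values in $W$). Say that a formal deformation $F$ of $kP$ is given by a $2$-cocycle $\omega$ if $F(E^{ij},E^{jl})=\omega(i,j,l)E^{il}$, meaning that for all $a,b\in kP$, $n\ge 0$ and $i,l\in P$ one has $F_n(a,b)(i,l)=\sum_{i\le j\le l}\omega_n(i,j,l)\,a(i,j)\,b(j,l)$, where $F_0=m_A$ and $\omega_0=1$. Then every class in $H^2(P;W)$ contains a cocycle that gives a formal deformation of $kP$, and there is a unique bijection $$\Psi\colon H^2(P;W)\longrightarrow\{\text{equivalence classes of formal deformations of }kP\}$$ such that $\Psi([\omega])=[F]$ whenever the formal deformation $F$ is given by the $2$-cocycle $\omega$. -/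

import Mathlib

open PowerSeries

/-! ### Formal deformations of an associative algebra

Throughout, `A⟦X⟧` is `A[[λ]]`, the variable `X` playing the role of `λ`. -/

section Deformation

variable {k A : Type*} [Field k] [Ring A] [Algebra k A]

/-- The `k[[λ]]`-linear extension to `A[[λ]]` of a family `f₀ + λ f₁ + λ² f₂ + …` of `k`-linear
endomorphisms of `A`: `∑ λ^q x_q ↦ ∑ₙ λⁿ ∑_{p + q = n} f_p (x_q)`. -/
noncomputable def formalExtend₁ (f : ℕ → A →ₗ[k] A) (x : A⟦X⟧) : A⟦X⟧ :=
  PowerSeries.mk fun n => ∑ p ∈ Finset.HasAntidiagonal.antidiagonal n, f p.1 (coeff p.2 x)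

/-- The `k[[λ]]`-bilinear extension to `A[[λ]]` of a family `F₀ + λ F₁ + λ² F₂ + …` of `k`-bilinear
maps `A × A → A`: `(x, y) ↦ ∑ₙ λⁿ ∑_{p + q + r = n} F_p (x_q, y_r)`. -/
noncomputable def formalExtend₂ (F : ℕ → A →ₗ[k] A →ₗ[k] A) (x y : A⟦X⟧) : A⟦X⟧ :=
  PowerSeries.mk fun n => ∑ p ∈ Finset.HasAntidiagonal.antidiagonal n, ∑ q ∈ Finset.HasAntidiagonal.antidiagonal p.2,
    F p.1 (coeff q.1 x) (coeff q.2 y)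

variable (k A) in
/-- A formal deformation of `A`: an associative product on `A[[λ]]` of the form
`m_A + λ F₁ + λ² F₂ + …` (extended `λ`-bilinearly) for which `1 ∈ A` is a unit. -/
structure FormalDeformation where
  /-- The coefficients `F_n` of the deformed product. -/
  term : ℕ → A →ₗ[k] A →ₗ[k] A
  term_zero : ∀ a b : A, term 0 a b = a * b
  assoc : ∀ x y z : A⟦X⟧, formalExtend₂ term (formalExtend₂ term x y) z =
    formalExtend₂ term x (formalExtend₂ term y z)
  one_left : ∀ a : A, formalExtend₂ term (C 1) (C a) = C a
  one_right : ∀ a : A, formalExtend₂ term (C a) (C 1) = C a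

/-- The deformed product on `A[[λ]]`. -/
noncomputable def FormalDeformation.mul (F : FormalDeformation k A) : A⟦X⟧ → A⟦X⟧ → A⟦X⟧ :=
  formalExtend₂ F.term

/-- Two formal deformations `F`, `F'` are equivalent if there is an algebra isomorphism
`f : (A[[λ]], F') → (A[[λ]], F)` of the form `f = id + λ f₁ + λ² f₂ + …`. -/
def FormalDeformation.Equivalent (F F' : FormalDeformation k A) : Prop :=
  ∃ f : ℕ → A →ₗ[k] A, f 0 = LinearMap.id ∧ Function.Bijective (formalExtend₁ f) ∧
    ∀ x y : A⟦X⟧, formalExtend₁ f (F'.mul x y) = F.mul (formalExtend₁ f x) (formalExtend₁ f y)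

/-- Composition of formal series of endomorphisms is the product of power series over `End A`. -/
lemma formalExtend₁_mul (f g : (Module.End k A)⟦X⟧) (x : A⟦X⟧) :
    formalExtend₁ (fun n => coeff n (f * g)) x =
      formalExtend₁ (fun n => coeff n f) (formalExtend₁ (fun n => coeff n g) x) := by
  ext n
  simp only [formalExtend₁, coeff_mk, coeff_mul, LinearMap.sum_apply, Module.End.mul_apply,
    map_sum, Finset.sum_sigma']
  apply Finset.sum_nbij' (fun ⟨⟨_i, j⟩, ⟨k, l⟩⟩ ↦ ⟨(k, l + j), (l, j)⟩)
    (fun ⟨⟨i, _j⟩, ⟨k, l⟩⟩ ↦ ⟨(i + k, l), (i, k)⟩)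
  all_goals
    rintro ⟨⟨a, b⟩, ⟨c, d⟩⟩ h
    simp only [Finset.mem_sigma, Finset.HasAntidiagonal.mem_antidiagonal] at h
    obtain ⟨h1, h2⟩ := h
    subst h2
    subst h1
    simp [add_assoc]

lemma formalExtend₁_one (x : A⟦X⟧) :
    formalExtend₁ (fun n => coeff n (1 : (Module.End k A)⟦X⟧)) x = x := by
  ext n
  simp only [formalExtend₁, coeff_mk]
  rw [Finset.sum_eq_single (0, n)]
  · simp
  · rintro ⟨p, q⟩ h hne
    have hp : p ≠ 0 := by
      rintro rfl
      simp_all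
    simp [coeff_one, hp]
  · simp

lemma FormalDeformation.Equivalent.refl (F : FormalDeformation k A) : F.Equivalent F := by
  have h := formalExtend₁_one (k := k) (A := A)
  refine ⟨fun n => coeff n (1 : (Module.End k A)⟦X⟧), ?_, ?_, fun x y => by simp only [h]⟩
  · simp [Module.End.one_eq_id]
  · rw [show formalExtend₁ (fun n => coeff n (1 : (Module.End k A)⟦X⟧)) = id from funext h]
    exact Function.bijective_id

lemma FormalDeformation.Equivalent.symm {F F' : FormalDeformation k A}
    (h : F.Equivalent F') : F'.Equivalent F := by
  obtain ⟨f, h0, -, hmul⟩ := h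
  let φ : (Module.End k A)⟦X⟧ := PowerSeries.mk f
  have hφ : (fun n => coeff n φ) = f := funext fun n => by simp [φ]
  have h1 : constantCoeff φ = ((1 : (Module.End k A)ˣ) : Module.End k A) := by
    rw [← coeff_zero_eq_constantCoeff_apply, coeff_mk, h0]
    rfl
  let ψ := invOfUnit φ 1
  have hl : ∀ x, formalExtend₁ (fun n => coeff n ψ) (formalExtend₁ f x) = x := fun x => by
    rw [← hφ, ← formalExtend₁_mul, invOfUnit_mul φ 1 h1, formalExtend₁_one]
  have hr : ∀ x, formalExtend₁ f (formalExtend₁ (fun n => coeff n ψ) x) = x := fun x => by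
    rw [← hφ, ← formalExtend₁_mul, mul_invOfUnit φ 1 h1, formalExtend₁_one]
  refine ⟨fun n => coeff n ψ, ?_, ⟨Function.LeftInverse.injective hr,
    Function.RightInverse.surjective hl⟩, fun x y => ?_⟩
  · change coeff 0 ψ = _
    rw [coeff_zero_eq_constantCoeff_apply, constantCoeff_invOfUnit]
    rfl
  · conv_lhs => rw [← hr x, ← hr y, ← hmul, hl]

lemma FormalDeformation.Equivalent.trans {F F' F'' : FormalDeformation k A}
    (h : F.Equivalent F') (h' : F'.Equivalent F'') : F.Equivalent F'' := by
  obtain ⟨f, h0, hb, hmul⟩ := h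
  obtain ⟨g, h0', hb', hmul'⟩ := h'
  let φ : (Module.End k A)⟦X⟧ := PowerSeries.mk f
  let ψ : (Module.End k A)⟦X⟧ := PowerSeries.mk g
  have hφ : (fun n => coeff n φ) = f := funext fun n => by simp [φ]
  have hψ : (fun n => coeff n ψ) = g := funext fun n => by simp [ψ]
  have hc : ∀ x, formalExtend₁ (fun n => coeff n (φ * ψ)) x =
      formalExtend₁ f (formalExtend₁ g x) := fun x => by
    rw [formalExtend₁_mul, hφ, hψ]
  refine ⟨fun n => coeff n (φ * ψ), ?_, ?_, fun x y => ?_⟩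
  · simp [coeff_mul, φ, ψ, h0, h0', Module.End.mul_eq_comp]
  · rw [show formalExtend₁ (fun n => coeff n (φ * ψ)) = formalExtend₁ f ∘ formalExtend₁ g from
      funext hc]
    exact hb.comp hb'
  · simp only [hc, hmul', hmul]

variable (k A) in
/-- Equivalence of formal deformations as an equivalence relation. -/
def FormalDeformation.setoid : Setoid (FormalDeformation k A) where
  r := FormalDeformation.Equivalent
  iseqv := ⟨FormalDeformation.Equivalent.refl, FormalDeformation.Equivalent.symm,
    FormalDeformation.Equivalent.trans⟩

variable (k A) in
/-- The set of equivalence classes of formal deformations of `A`. -/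
def DeformationClasses := Quotient (FormalDeformation.setoid k A)

/-- The equivalence class of a formal deformation. -/
def FormalDeformation.toClass (F : FormalDeformation k A) : DeformationClasses k A :=
  Quotient.mk (FormalDeformation.setoid k A) F

end Deformation

/-! ### Cohomology of a poset with coefficients in an abelian group, written multiplicatively -/

section Cohomology

variable {P G : Type*} [PartialOrder P] [CommGroup G]

variable (P G) in
/-- Simplicial `n`-cochains on the nerve of `P`: functions on the set of `n`-simplices
`v₀ ≤ v₁ ≤ ⋯ ≤ vₙ`, with pointwise multiplication. -/
abbrev PosetCochain (n : ℕ) := (Fin (n + 1) →o P) → G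

/-- The `i`-th face of a simplex: omit the vertex `vᵢ`. -/
def simplexFace {n : ℕ} (i : Fin (n + 2)) (v : Fin (n + 2) →o P) : Fin (n + 1) →o P :=
  v.comp (Fin.succAboveOrderEmb i).toOrderHom

variable (P G) in
/-- The simplicial coboundary `(dφ)(v) = ∏ᵢ φ(dᵢ v)^((-1)^i)`. -/
def posetCoboundary (n : ℕ) : PosetCochain P G n →* PosetCochain P G (n + 1) where
  toFun φ := fun v => ∏ i : Fin (n + 2), φ (simplexFace i v) ^ ((-1 : ℤ) ^ (i : ℕ))
  map_one' := by
    funext v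
    simp
  map_mul' φ ψ := by
    funext v
    simp [mul_zpow, Finset.prod_mul_distrib]

variable (P G) in
/-- The group `Z²(P; G)` of `2`-cocycles. -/
abbrev PosetZ2 : Subgroup (PosetCochain P G 2) := (posetCoboundary P G 2).ker

variable (P G) in
/-- The group `B²(P; G)` of `2`-coboundaries, as a subgroup of `Z²(P; G)`. -/
abbrev PosetB2 : Subgroup (PosetZ2 P G) := (posetCoboundary P G 1).range.subgroupOf (PosetZ2 P G)

variable (P G) in
/-- The cohomology group `H²(P; G)`. -/
abbrev PosetH2 := PosetZ2 P G ⧸ PosetB2 P G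

/-- The `2`-simplex `i ≤ j ≤ l`. -/
def simplex₂ {i j l : P} (hij : i ≤ j) (hjl : j ≤ l) : Fin 3 →o P where
  toFun := ![i, j, l]
  monotone' := by
    rw [Fin.monotone_iff_le_succ]
    intro x
    fin_cases x <;> simpa

end Cohomology

/-! ### Big Witt vectors and the deformation attached to a cocycle -/

/-- The multiplicative group `W = 1 + λ k[[λ]]` of big Witt vectors. -/
noncomputable abbrev BigWittGroup (k : Type*) [Field k] : Subgroup k⟦X⟧ˣ :=
  (Units.map (constantCoeff (R := k)).toMonoidHom).ker

/-- The deformation `F` of the incidence algebra is the one attached to the cochain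
`ω = 1 + λ ω₁ + λ² ω₂ + …`: it is given by `F (E^{ij}, E^{jl}) = ω(i, j, l) E^{il}`, that is,
`F_n (a, b)(i, l) = ∑_{i ≤ j ≤ l} ω_n(i, j, l) a(i, j) b(j, l)`. -/
def FormalDeformation.IsGivenBy {k P : Type*} [Field k] [PartialOrder P] [LocallyFiniteOrder P]
    [DecidableEq P] (F : FormalDeformation k (IncidenceAlgebra k P))
    (ω : PosetCochain P (BigWittGroup k) 2) : Prop :=
  ∀ (n : ℕ) (a b : IncidenceAlgebra k P) (i l : P),
    F.term n a b i l = ∑ j : Finset.Icc i l,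
      coeff n ((ω (simplex₂ (Finset.mem_Icc.1 j.2).1 (Finset.mem_Icc.1 j.2).2) : k⟦X⟧ˣ) : k⟦X⟧) *
        (a i j * b j l)

/-! A deformation of `kP` is a `k[[λ]]`-algebra `B` of incidence matrices over `k[[λ]]` which
reduces to `kP` modulo `λ`, and `λ`-adic completeness lets the matrix units be lifted to it. The
`E^{ii}` lift to orthogonal idempotents `η_i` (`exists_idempotent_lift`,
`exists_orthogonal_idempotents`). The corner `η_i B η_j` is zero unless `i ≤ j`, and is then free of
rank one on a lift `v_{ij}` of `E^{ij}`. Hence `v_{ij} v_{jl} = ω(i,j,l) v_{il}` with `ω(i,j,l)` in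
`W`, and associativity makes `ω` a cocycle. Reading an element in the coordinates given by the
`v_{ij}` is the identity modulo `λ`, hence bijective, and carries the product of `B` to the one
given by `ω` (`entries_coord_mul`). So every deformation is equivalent to one given by a cocycle.

Conversely, a cocycle gives an associative product, with unit `1` once it is normalized, and each
class has a normalized representative (`exists_normalized`). Cohomologous cocycles give equivalent
deformations by rescaling the `E^{ij}` (`IsGivenByFun.equivalent`). An equivalence produces a second
system of matrix units in the same algebra; an element `u` congruent to `1` intertwines the two
systems up to scalars, and these scalars form the cochain whose coboundary relates the cocycles
(`IsGivenByFun.cohomologous`).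

As `P` may be infinite, sums such as `∑ η_j` are not available in `B`. They are replaced by elements
with prescribed entries, using that linear maps which are the identity modulo `λ` are bijective
(`bijective_of_red`). -/

/-! ### Matrix units of the incidence algebra. -/

namespace IncidenceAlgebra

variable {R P : Type*} [Semiring R] [PartialOrder P] [DecidableEq P]

/-- The matrix unit `E^{ij}` (zero unless `i ≤ j`). -/
noncomputable def single (R : Type*) [Semiring R] (i j : P) : IncidenceAlgebra R P where
  toFun a b := by
    classical exact if a = i ∧ b = j ∧ i ≤ j then 1 else 0
  eq_zero_of_not_le' a b h := by
    rw [if_neg]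
    rintro ⟨rfl, rfl, h'⟩
    exact h h'

lemma single_apply_self {i j : P} (h : i ≤ j) : single R i j i j = 1 := by
  simp [single, h]

lemma single_apply_of_le {i j : P} (h : i ≤ j) (a b : P) :
    single R i j a b = if a = i ∧ b = j then 1 else 0 := by
  by_cases h' : a = i ∧ b = j <;> simp_all [single]

variable [LocallyFiniteOrder P]

lemma single_self_mul_apply (i : P) (x : IncidenceAlgebra R P) (a b : P) :
    (single R i i * x) a b = if a = i then x i b else 0 := by
  by_cases hab : a ≤ b
  · simp only [mul_apply, single_apply_of_le le_rfl]
    split_ifs with h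
    · subst h
      rw [Finset.sum_eq_single a] <;> simp_all
    · simp [h]
  · rw [apply_eq_zero_of_not_le hab]
    split_ifs with h
    · rw [apply_eq_zero_of_not_le (h ▸ hab)]
    · rfl

lemma mul_single_self_apply (j : P) (x : IncidenceAlgebra R P) (a b : P) :
    (x * single R j j) a b = if b = j then x a j else 0 := by
  by_cases hab : a ≤ b
  · simp only [mul_apply, single_apply_of_le le_rfl]
    split_ifs with h
    · subst h
      rw [Finset.sum_eq_single b] <;> simp_all
    · simp [h]
  · rw [apply_eq_zero_of_not_le hab]
    split_ifs with h
    · rw [apply_eq_zero_of_not_le (h ▸ hab)]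
    · rfl

lemma single_self_mul_single {i j : P} : single R i i * single R i j = single R i j := by
  ext a b _
  rw [single_self_mul_apply]
  split_ifs with h
  · rw [h]
  · simp [single, h]

lemma single_mul_single_self {i j : P} : single R i j * single R j j = single R i j := by
  ext a b _
  rw [mul_single_self_apply]
  split_ifs with h
  · rw [h]
  · simp [single, h]

lemma single_mul_single {i j l : P} (hij : i ≤ j) (hjl : j ≤ l) :
    single R i j * single R j l = single R i l := by
  ext a b _
  simp only [mul_apply, single_apply_of_le hij, single_apply_of_le hjl,
    single_apply_of_le (hij.trans hjl)]
  by_cases h : a = i ∧ b = l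
  · obtain ⟨rfl, rfl⟩ := h
    rw [Finset.sum_eq_single j] <;> simp_all
  · rw [if_neg h]
    apply Finset.sum_eq_zero
    intro x _
    by_cases h1 : a = i <;> simp_all

end IncidenceAlgebra

/-! ### Completeness and lifting modulo `λ`. -/

section Model

variable {k P B : Type*} [Field k] [PartialOrder P] [LocallyFiniteOrder P] [DecidableEq P]
  [Ring B] [Algebra k⟦X⟧ B]

variable (k P B) in
/-- A `k[[λ]]`-algebra `B` whose underlying module consists of the incidence matrices over `k[[λ]]`
and whose reduction modulo `λ` is the incidence algebra of `P` over `k`. -/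
structure IncidenceModel where
  /-- The matrix of entries of an element. -/
  entries : B ≃ₗ[k⟦X⟧] IncidenceAlgebra k⟦X⟧ P
  /-- Reduction modulo `λ`. -/
  red : B →+* IncidenceAlgebra k P
  red_apply : ∀ x i j, red x i j = constantCoeff (entries x i j)

namespace IncidenceModel

variable (T : IncidenceModel k P B)

lemma ext_entries {x y : B} (h : ∀ i j, i ≤ j → T.entries x i j = T.entries y i j) : x = y :=
  T.entries.injective (IncidenceAlgebra.ext h)

lemma entries_smul (c : k⟦X⟧) (x : B) (i j : P) :
    T.entries (c • x) i j = c * T.entries x i j := by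
  rw [map_smul, IncidenceAlgebra.constSMul_apply, smul_eq_mul]

lemma entries_add (x y : B) (i j : P) :
    T.entries (x + y) i j = T.entries x i j + T.entries y i j := by
  rw [map_add, IncidenceAlgebra.add_apply]

lemma entries_sub (x y : B) (i j : P) :
    T.entries (x - y) i j = T.entries x i j - T.entries y i j := by
  rw [map_sub, IncidenceAlgebra.sub_apply]

lemma entries_zero (i j : P) : T.entries 0 i j = 0 := by
  rw [map_zero, IncidenceAlgebra.zero_apply]

open Classical in
/-- The element with prescribed entries. -/
noncomputable def ofEntries (m : P → P → k⟦X⟧) : B :=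
  T.entries.symm ⟨fun i j => if i ≤ j then m i j else 0, fun _ _ h => if_neg h⟩

lemma entries_ofEntries (m : P → P → k⟦X⟧) {i j : P} (h : i ≤ j) :
    T.entries (T.ofEntries m) i j = m i j := by
  simp [ofEntries, h]

lemma red_smul (c : k⟦X⟧) (x : B) : T.red (c • x) = constantCoeff c • T.red x := by
  ext i j _
  rw [T.red_apply, entries_smul, IncidenceAlgebra.constSMul_apply, T.red_apply, map_mul,
    smul_eq_mul]

include T in
lemma X_smul_injective {x y : B} (h : (X : k⟦X⟧) • x = (X : k⟦X⟧) • y) : x = y := by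
  apply T.ext_entries
  intro i j _
  apply X_mul_cancel
  rw [← entries_smul, ← entries_smul, h]

lemma exists_X_smul {x : B} (h : T.red x = 0) : ∃ y : B, x = (X : k⟦X⟧) • y := by
  have h' : ∀ i j, ∃ c, T.entries x i j = X * c := fun i j => by
    rw [← dvd_def, X_dvd_iff, ← T.red_apply, h, IncidenceAlgebra.zero_apply]
  choose c hc using h'
  refine ⟨T.ofEntries c, T.ext_entries fun i j hij => ?_⟩
  rw [entries_smul, T.entries_ofEntries c hij, hc]

lemma red_X_smul (x : B) : T.red ((X : k⟦X⟧) • x) = 0 := by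
  rw [red_smul, constantCoeff_X, zero_smul]

include T in
/-- An element divisible arbitrarily often by `λ` vanishes. -/
lemma eq_zero_of_divisible (Q : B → Prop) (hQ : ∀ x, Q x → ∃ y, x = (X : k⟦X⟧) • y ∧ Q y) {x : B}
    (hx : Q x) : x = 0 := by
  have h : ∀ n : ℕ, ∀ x, Q x → ∀ i j, coeff n (T.entries x i j) = 0 := by
    intro n
    induction n with
    | zero =>
      intro x hx i j
      obtain ⟨y, rfl, -⟩ := hQ x hx
      rw [entries_smul, coeff_zero_X_mul]
    | succ n ih =>
      intro x hx i j
      obtain ⟨y, rfl, hy⟩ := hQ x hx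
      rw [entries_smul, coeff_succ_X_mul, ih y hy]
  apply T.ext_entries
  intro i j _
  ext n
  rw [h n x hx, entries_zero, map_zero]

include T in
/-- Completeness: the series `∑ₙ λⁿ y_{m+n}` converge. -/
lemma exists_tail_sums (y : ℕ → B) : ∃ s : ℕ → B, ∀ m, s m = y m + (X : k⟦X⟧) • s (m + 1) := by
  refine ⟨fun m => T.ofEntries fun i j => PowerSeries.mk fun n =>
    ∑ t ∈ Finset.range (n + 1), coeff (n - t) (T.entries (y (m + t)) i j), fun m => ?_⟩
  apply T.ext_entries
  intro i j hij
  rw [entries_add, entries_smul, entries_ofEntries _ _ hij, entries_ofEntries _ _ hij]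
  ext n
  cases n with
  | zero => simp
  | succ n =>
    rw [map_add, coeff_succ_X_mul, coeff_mk, coeff_mk, Finset.sum_range_succ', add_comm]
    simp [add_assoc, add_comm 1]

/-- A `k[[λ]]`-linear map which is the identity modulo `λ` is bijective. -/
lemma bijective_of_red {h : B →ₗ[k⟦X⟧] B} (hh : ∀ x, T.red (h x) = T.red x) :
    Function.Bijective h := by
  constructor
  · rw [← LinearMap.ker_eq_bot, LinearMap.ker_eq_bot']
    intro x hx
    refine T.eq_zero_of_divisible (fun x => h x = 0) (fun x hx => ?_) hx
    obtain ⟨y, rfl⟩ := T.exists_X_smul (x := x) (by rw [← hh, hx, map_zero])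
    refine ⟨y, rfl, T.X_smul_injective ?_⟩
    rw [← map_smul, hx, smul_zero]
  -- Neumann series: writing `h = 1 + λN`, the preimage of `y` is `∑ λ^m (-N)^m y`. The error `h (s
  -- m) - (-N)^m y` is `λ` times the error for `m + 1`, so it vanishes.
  · have h' : ∀ x, ∃ z, h x = x + (X : k⟦X⟧) • z := fun x => by
      obtain ⟨z, hz⟩ := T.exists_X_smul (x := h x - x) (by rw [map_sub, hh, sub_self])
      exact ⟨z, by rw [← hz]; abel⟩
    choose N hN using h'
    intro y
    obtain ⟨s, hs⟩ := T.exists_tail_sums fun m => (fun y => -N y)^[m] y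
    refine ⟨s 0, ?_⟩
    rw [← sub_eq_zero]
    refine T.eq_zero_of_divisible (fun z => ∃ m, z = h (s m) - (fun y => -N y)^[m] y) ?_ ⟨0, rfl⟩
    rintro _ ⟨m, rfl⟩
    refine ⟨_, ?_, m + 1, rfl⟩
    rw [hs m, map_add, hN, map_smul, Function.iterate_succ_apply', smul_sub, smul_neg]
    abel

/-- Idempotents lift along reduction modulo `λ`. -/
lemma exists_idempotent_lift {e : IncidenceAlgebra k P} (he : e * e = e) :
    ∃ ε : B, ε * ε = ε ∧ T.red ε = e := by
  obtain ⟨x₀, hx₀⟩ : ∃ x : B, T.red x = e := ⟨T.ofEntries fun i j => C (e i j), by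
    ext i j hij
    rw [T.red_apply, entries_ofEntries _ _ hij, constantCoeff_C]⟩
  -- Newton step `x ↦ 3x² - 2x³ = x + δ(1 - 2x)` with `δ = x² - x`: the new defect is `δ²(4x² - 4x -
  -- 3)`. It is divisible by `λ^(2n+2)`, of which only `λ^(n+2)` is needed.
  have step : ∀ (n : ℕ) (x y : B), x * x - x = (X : k⟦X⟧) ^ (n + 1) • y →
      ∃ d z : B, (x + (X : k⟦X⟧) ^ (n + 1) • d) * (x + (X : k⟦X⟧) ^ (n + 1) • d) -
        (x + (X : k⟦X⟧) ^ (n + 1) • d) = (X : k⟦X⟧) ^ (n + 2) • z := by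
    intro n x y hxy
    refine ⟨y * (1 - 2 * x), (X : k⟦X⟧) ^ n • (y * y * (4 * x * x - 4 * x - 3)), ?_⟩
    have h1 : (X : k⟦X⟧) ^ (n + 2) • (X : k⟦X⟧) ^ n • (y * y * (4 * x * x - 4 * x - 3)) =
        ((X : k⟦X⟧) ^ (n + 1) • y) * ((X : k⟦X⟧) ^ (n + 1) • y) * (4 * x * x - 4 * x - 3) := by
      simp only [smul_mul_assoc, mul_smul_comm, smul_smul]
      congr 1
      ring
    rw [h1, ← smul_mul_assoc, ← hxy]
    noncomm_ring
  choose! d z hd using step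
  obtain ⟨y₀, hy₀⟩ := T.exists_X_smul (x := x₀ * x₀ - x₀)
    (by rw [map_sub, map_mul, hx₀, he, sub_self])
  let p : ℕ → B × B := fun n => Nat.rec (x₀, y₀)
    (fun n p => (p.1 + (X : k⟦X⟧) ^ (n + 1) • d n p.1 p.2, z n p.1 p.2)) n
  have hp : ∀ n, (p n).1 * (p n).1 - (p n).1 = (X : k⟦X⟧) ^ (n + 1) • (p n).2 := by
    intro n
    induction n with
    | zero => simpa [p] using hy₀
    | succ n ih => exact hd n _ _ ih
  obtain ⟨s, hs⟩ := T.exists_tail_sums fun n => d n (p n).1 (p n).2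
  -- The limit agrees with the `n`-th approximation modulo `λ^(n+1)`, so its defect is divisible by
  -- every power of `λ`.
  have hx : ∀ n, x₀ + (X : k⟦X⟧) • s 0 = (p n).1 + (X : k⟦X⟧) ^ (n + 1) • s n := by
    intro n
    induction n with
    | zero => simp [p]
    | succ n ih =>
      rw [ih, hs n, smul_add, smul_smul, ← pow_succ, ← add_assoc]
  refine ⟨x₀ + (X : k⟦X⟧) • s 0, ?_, by rw [map_add, red_X_smul, hx₀, add_zero]⟩
  rw [← sub_eq_zero]
  refine T.eq_zero_of_divisible (fun w => ∀ n, ∃ v, w = (X : k⟦X⟧) ^ n • v) (fun w hw => ?_)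
    fun n => ?_
  · obtain ⟨v, hv⟩ := hw 1
    rw [pow_one] at hv
    refine ⟨v, hv, fun n => ?_⟩
    obtain ⟨u, hu⟩ := hw (n + 1)
    refine ⟨u, T.X_smul_injective ?_⟩
    rw [← hv, hu, smul_smul, pow_succ']
  · refine ⟨(X : k⟦X⟧) • ((p n).2 + (p n).1 * s n + s n * (p n).1 +
      (X : k⟦X⟧) ^ (n + 1) • (s n * s n) - s n), ?_⟩
    rw [hx n, smul_smul, ← pow_succ, smul_sub, smul_add, smul_add, smul_add, ← hp n]
    simp only [mul_add, add_mul, smul_mul_assoc, mul_smul_comm, smul_add]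
    abel

end IncidenceModel
end Model

open IncidenceAlgebra

/-! ### Orthogonal idempotents, Peirce corners and structure constants. -/

section Frame

variable {k P B : Type*} [Field k] [PartialOrder P] [LocallyFiniteOrder P] [DecidableEq P]
  [Ring B] [Algebra k⟦X⟧ B]

namespace IncidenceModel

variable (T : IncidenceModel k P B)

/-- The elements of the right ideal generated by a lift of `E^{ii}` are determined by their
`i`-th row. -/
lemma eq_zero_of_row {i : P} {ε x : B} (hε : T.red ε = single k i i) (hx : ε * x = x)
    (h : ∀ j, T.entries x i j = 0) : x = 0 := by
  -- Modulo `λ`, `x = εx` is supported on row `i`, where it vanishes. So `λ` divides `x`, and the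
  -- quotient inherits both conditions.
  refine T.eq_zero_of_divisible (fun x => ε * x = x ∧ ∀ j, T.entries x i j = 0) ?_ ⟨hx, h⟩
  rintro x ⟨hx, h⟩
  obtain ⟨y, rfl⟩ := T.exists_X_smul (x := x) <| by
    ext a b _
    rw [← hx, map_mul, hε, single_self_mul_apply, T.red_apply, h]
    simp
  refine ⟨y, rfl, T.X_smul_injective (by rwa [← mul_smul_comm]), fun j => ?_⟩
  apply X_mul_cancel
  rw [← entries_smul, h, mul_zero]

/-- If `ε` and `ε'` lift `E^{ii}` and `E^{jj}`, an element `x = ε x ε'` is determined by its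
`(i, j)` entry. -/
lemma eq_zero_of_entry {i j : P} {ε ε' x : B} (hε : T.red ε = single k i i)
    (hε' : T.red ε' = single k j j) (hx : ε * x = x) (hx' : x * ε' = x)
    (h : T.entries x i j = 0) : x = 0 := by
  refine T.eq_zero_of_divisible (fun x => ε * x = x ∧ x * ε' = x ∧ T.entries x i j = 0) ?_
    ⟨hx, hx', h⟩
  rintro x ⟨hx, hx', h⟩
  obtain ⟨y, rfl⟩ := T.exists_X_smul (x := x) <| by
    ext a b _
    rw [← hx, map_mul, hε, single_self_mul_apply, ← hx', map_mul, hε', mul_single_self_apply,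
      T.red_apply, h]
    simp
  refine ⟨y, rfl, T.X_smul_injective (by rwa [← mul_smul_comm]),
    T.X_smul_injective (by rwa [← smul_mul_assoc]), ?_⟩
  apply X_mul_cancel
  rw [← entries_smul, h, mul_zero]

lemma eq_of_entry {i j : P} {ε ε' x y : B} (hε : T.red ε = single k i i)
    (hε' : T.red ε' = single k j j) (hx : ε * x = x) (hx' : x * ε' = x) (hy : ε * y = y)
    (hy' : y * ε' = y) (h : T.entries x i j = T.entries y i j) : x = y := by
  rw [← sub_eq_zero]
  refine T.eq_zero_of_entry hε hε' ?_ ?_ ?_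
  · rw [mul_sub, hx, hy]
  · rw [sub_mul, hx', hy']
  · rw [entries_sub, h, sub_self]

/-- The matrix units `E^{ii}` lift to orthogonal idempotents. -/
lemma exists_orthogonal_idempotents : ∃ η : P → B, (∀ i, T.red (η i) = single k i i) ∧
    ∀ i j, η i * η j = if i = j then η i else 0 := by
  choose ε hε hred using fun i : P =>
    T.exists_idempotent_lift (e := single k i i) single_self_mul_single
  -- Row `i` of `h x` is row `i` of `ε_i x`. Modulo `λ` this is the identity, so an element can be
  -- prescribed through its products with all the `ε_i`.
  let h : B →ₗ[k⟦X⟧] B :=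
    { toFun := fun x => T.ofEntries fun i j => T.entries (ε i * x) i j
      map_add' := fun x y => T.ext_entries fun i j hij => by
        simp only [entries_add, T.entries_ofEntries _ hij, mul_add]
      map_smul' := fun c x => T.ext_entries fun i j hij => by
        simp only [entries_smul, T.entries_ofEntries _ hij, mul_smul_comm, RingHom.id_apply] }
  have h_apply : ∀ x i j, T.entries (h x) i j = T.entries (ε i * x) i j := fun x i j => by
    by_cases hij : i ≤ j
    · exact T.entries_ofEntries _ hij
    · rw [apply_eq_zero_of_not_le hij, apply_eq_zero_of_not_le hij]
  have hbij : Function.Bijective h := T.bijective_of_red fun x => by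
    ext i j _
    rw [T.red_apply, h_apply, ← T.red_apply, map_mul, hred, single_self_mul_apply, if_pos rfl]
  have hext : ∀ x y, (∀ i, ε i * x = ε i * y) → x = y := fun x y hxy =>
    hbij.1 <| T.ext_entries fun i j _ => by rw [h_apply, h_apply, hxy]
  -- The lifts `ε_i` need not be orthogonal; the dual system defined by `ε_j η_i = δ_{ij} ε_j` is,
  -- because `ε_l η_i η_j = δ_{li} δ_{lj} ε_l` for every `l`.
  have hη : ∀ i, ∃ η, ∀ j, ε j * η = if j = i then ε j else 0 := by
    intro i
    obtain ⟨η, hη⟩ := hbij.2 (T.ofEntries fun a b => if a = i then T.entries (ε i) i b else 0)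
    refine ⟨η, fun j => ?_⟩
    rw [← sub_eq_zero]
    refine T.eq_zero_of_row (hred j) ?_ fun l => ?_
    · rw [mul_sub, ← mul_assoc, hε]
      split_ifs
      · rw [hε]
      · rw [mul_zero]
    · by_cases hjl : j ≤ l
      · rw [entries_sub, ← h_apply, hη, T.entries_ofEntries _ hjl]
        split_ifs with hji
        · rw [hji, sub_self]
        · rw [entries_zero, sub_self]
      · exact apply_eq_zero_of_not_le hjl _
  choose η hη using hη
  refine ⟨η, fun i => ?_, fun i j => hext _ _ fun l => ?_⟩
  · ext a b hab
    have := congrArg (fun x => T.red x a b) (hη i a)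
    simp only [map_mul, hred, single_self_mul_apply, if_true] at this
    rw [this]
    by_cases hai : a = i
    · rw [if_pos hai, hred, hai]
    · simp [hai, single_apply_of_le le_rfl]
  · rw [← mul_assoc, hη]
    by_cases hij : i = j
    · subst hij
      by_cases hli : l = i <;> simp [hli, hη]
    · by_cases hli : l = i
      · subst hli; simp [hij, hη]
      · simp [hij, hli]

/-- A system of orthogonal idempotents lifting the matrix units `E^{ii}`, together with lifts of the
matrix units `E^{ij}` compatible with them. -/
structure Frame where
  /-- The orthogonal idempotents. -/
  idem : P → B
  /-- The lifted matrix units. -/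
  unit : P → P → B
  red_idem : ∀ i, T.red (idem i) = single k i i
  idem_mul_idem : ∀ i j, idem i * idem j = if i = j then idem i else 0
  red_unit : ∀ {i j}, i ≤ j → T.red (unit i j) = single k i j
  idem_mul_unit : ∀ i j, idem i * unit i j = unit i j
  unit_mul_idem : ∀ i j, unit i j * idem j = unit i j
  unit_self : ∀ i, unit i i = idem i

lemma nonempty_frame : Nonempty T.Frame := by
  obtain ⟨η, hred, hη⟩ := T.exists_orthogonal_idempotents
  have hsq : ∀ i, η i * η i = η i := fun i => by rw [hη, if_pos rfl]
  have hE : ∀ i j : P, ∃ v : B, T.red v = single k i j := fun i j =>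
    ⟨T.ofEntries fun a b => C (single k i j a b), by
      ext a b hab
      rw [T.red_apply, entries_ofEntries _ _ hab, constantCoeff_C]⟩
  choose v hv using hE
  -- Any lift of `E^{ij}` is cut down to the corner. Taking `η_i` itself on the diagonal makes the
  -- structure constants normalized.
  refine ⟨⟨η, fun i j => if i = j then η i else η i * v i j * η j, hred, hη, ?_, ?_, ?_, ?_⟩⟩
  · intro i j _
    split_ifs with h
    · rw [← h, hred]
    · rw [map_mul, map_mul, hred, hred, hv, single_self_mul_single, single_mul_single_self]
  · intro i j
    split_ifs
    · exact hsq i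
    · rw [← mul_assoc, ← mul_assoc, hsq]
  · intro i j
    split_ifs with h
    · rw [h, hsq]
    · rw [mul_assoc, hsq]
  · intro i
    exact if_pos rfl

namespace Frame

variable {T} (S : T.Frame)

lemma idem_mul_self (i : P) : S.idem i * S.idem i = S.idem i := by
  rw [S.idem_mul_idem, if_pos rfl]

lemma idem_mul_of_ne {i j : P} (h : i ≠ j) : S.idem i * S.idem j = 0 := by
  rw [S.idem_mul_idem, if_neg h]

/-- The leading entry of a lifted matrix unit. -/
noncomputable def lead (i j : P) : k⟦X⟧ := T.entries (S.unit i j) i j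

lemma lead_ne {i j : P} (h : i ≤ j) : constantCoeff (S.lead i j) ≠ 0 := by
  rw [lead, ← T.red_apply, S.red_unit h, single_apply_self h]
  exact one_ne_zero

lemma constantCoeff_inv_lead {i j : P} (h : i ≤ j) : constantCoeff (S.lead i j)⁻¹ = 1 := by
  rw [constantCoeff_inv, lead, ← T.red_apply, S.red_unit h, single_apply_self h, inv_one]

/-- An element `x = η_i x η_j` is a multiple of the lifted matrix unit. -/
lemma eq_smul_unit {i j : P} (h : i ≤ j) {x : B} (hx : S.idem i * x = x) (hx' : x * S.idem j = x) :
    x = ((S.lead i j)⁻¹ * T.entries x i j) • S.unit i j := by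
  refine T.eq_of_entry (S.red_idem i) (S.red_idem j) hx hx' ?_ ?_ ?_
  · rw [mul_smul_comm, S.idem_mul_unit]
  · rw [smul_mul_assoc, S.unit_mul_idem]
  · rw [T.entries_smul, mul_right_comm, ← lead, PowerSeries.inv_mul_cancel _ (S.lead_ne h), one_mul]

/-- Coordinates of an element with respect to a frame, as an endomorphism of the underlying
module. -/
noncomputable def coord : B →ₗ[k⟦X⟧] B where
  toFun x := T.ofEntries fun i j => (S.lead i j)⁻¹ * T.entries (S.idem i * x * S.idem j) i j
  map_add' x y := T.ext_entries fun i j hij => by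
    simp only [entries_add, T.entries_ofEntries _ hij, mul_add, add_mul]
  map_smul' c x := T.ext_entries fun i j hij => by
    simp only [entries_smul, T.entries_ofEntries _ hij, mul_smul_comm, smul_mul_assoc,
      RingHom.id_apply, mul_left_comm]

lemma entries_coord (x : B) {i j : P} (h : i ≤ j) : T.entries (S.coord x) i j =
    (S.lead i j)⁻¹ * T.entries (S.idem i * x * S.idem j) i j :=
  T.entries_ofEntries _ h

lemma red_coord (x : B) : T.red (S.coord x) = T.red x := by
  ext i j hij
  rw [T.red_apply, S.entries_coord x hij, map_mul, S.constantCoeff_inv_lead hij, one_mul,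
    ← T.red_apply, map_mul, map_mul, S.red_idem, S.red_idem, mul_single_self_apply, if_pos rfl,
    single_self_mul_apply, if_pos rfl]

lemma coord_bijective : Function.Bijective S.coord := T.bijective_of_red S.red_coord

lemma idem_mul_mul_idem (x : B) {i j : P} (h : i ≤ j) :
    S.idem i * x * S.idem j = T.entries (S.coord x) i j • S.unit i j := by
  rw [S.entries_coord x h]
  refine S.eq_smul_unit h ?_ ?_
  · rw [← mul_assoc, ← mul_assoc, S.idem_mul_self]
  · rw [mul_assoc, S.idem_mul_self]

/-- A corner element is determined by its `(i, j)` entry, and an incidence matrix has none when `i ≰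
j`. -/
lemma idem_mul_mul_idem_of_not_le (x : B) {i j : P} (h : ¬ i ≤ j) :
    S.idem i * x * S.idem j = 0 := by
  refine T.eq_zero_of_entry (S.red_idem i) (S.red_idem j) ?_ ?_ (apply_eq_zero_of_not_le h _)
  · rw [← mul_assoc, ← mul_assoc, S.idem_mul_self]
  · rw [mul_assoc, S.idem_mul_self]

lemma ext_idem {x y : B} (h : ∀ i j, S.idem i * x * S.idem j = S.idem i * y * S.idem j) :
    x = y :=
  S.coord_bijective.1 <| T.ext_entries fun i j hij => by
    rw [S.entries_coord x hij, S.entries_coord y hij, h]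

/-- This replaces the expansion of `η_i x` as a possibly infinite sum of its corner components. -/
lemma ext_idem_right {i : P} {x y : B} (h : ∀ j, S.idem i * x * S.idem j = S.idem i * y * S.idem j) :
    S.idem i * x = S.idem i * y := by
  refine S.ext_idem fun a b => ?_
  by_cases hai : a = i
  · subst hai
    rw [← mul_assoc, S.idem_mul_self, h, ← mul_assoc, S.idem_mul_self]
  · simp only [← mul_assoc, S.idem_mul_of_ne hai, zero_mul]

lemma ext_idem_left {j : P} {x y : B} (h : ∀ i, S.idem i * x * S.idem j = S.idem i * y * S.idem j) :
    x * S.idem j = y * S.idem j := by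
  refine S.ext_idem fun a b => ?_
  by_cases hbj : j = b
  · subst hbj
    simp only [mul_assoc, S.idem_mul_self]
    simpa only [mul_assoc] using h a
  · simp only [mul_assoc, S.idem_mul_of_ne hbj, mul_zero]

/-- The sum of the idempotents `η_j` over a set of vertices. -/
lemma exists_sum_idem (Q : P → Prop) [DecidablePred Q] : ∃ r : B,
    ∀ j, S.idem j * r = (if Q j then S.idem j else 0) ∧
      r * S.idem j = if Q j then S.idem j else 0 := by
  -- The sum may be infinite, so `r` is obtained from its coordinates by surjectivity of `coord`.
  obtain ⟨r, hr⟩ := S.coord_bijective.2 (T.ofEntries fun i j => if i = j ∧ Q j then 1 else 0)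
  have h : ∀ i j, S.idem i * r * S.idem j = if i = j ∧ Q j then S.idem i else 0 := by
    intro i j
    by_cases hij : i ≤ j
    · rw [S.idem_mul_mul_idem r hij, hr, T.entries_ofEntries _ hij]
      split_ifs with hh
      · rw [one_smul, ← hh.1, S.unit_self]
      · rw [zero_smul]
    · rw [S.idem_mul_mul_idem_of_not_le r hij, if_neg]
      rintro ⟨rfl, -⟩
      exact hij le_rfl
  refine ⟨r, fun j => ⟨?_, ?_⟩⟩
  · have := S.ext_idem_right (i := j) (x := r) (y := if Q j then S.idem j else 0) fun l => by
      rw [h]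
      by_cases hjl : j = l
      · subst hjl
        split_ifs <;> simp_all [S.idem_mul_self]
      · rw [if_neg (fun hh => hjl hh.1)]
        split_ifs
        · rw [S.idem_mul_self, S.idem_mul_of_ne hjl]
        · rw [mul_zero, zero_mul]
    rw [this]
    split_ifs
    · exact S.idem_mul_self j
    · exact mul_zero _
  · have := S.ext_idem_left (j := j) (x := r) (y := if Q j then S.idem j else 0) fun l => by
      rw [h]
      by_cases hjl : l = j
      · subst hjl
        split_ifs <;> simp_all [S.idem_mul_self]
      · rw [if_neg (fun hh => hjl hh.1)]
        split_ifs
        · rw [S.idem_mul_of_ne hjl, zero_mul]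
        · rw [mul_zero, zero_mul]
    rw [this]
    split_ifs
    · exact S.idem_mul_self j
    · exact zero_mul _

/-- Locality of the product: only the vertices of the interval `[i, l]` contribute to
`η_i x y η_l`. -/
lemma idem_mul_mul_mul_idem (x y : B) (i l : P) :
    S.idem i * (x * y) * S.idem l =
      ∑ j ∈ Finset.Icc i l, S.idem i * x * S.idem j * (S.idem j * y * S.idem l) := by
  classical
  -- It has to be shown that `η_i x w y η_l = 0`, where `w` is the complement of the idempotents of
  -- the interval.
  set w : B := 1 - ∑ j ∈ Finset.Icc i l, S.idem j with hw
  have hwj : ∀ j, w * S.idem j = if i ≤ j ∧ j ≤ l then 0 else S.idem j := by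
    intro j
    rw [hw, sub_mul, one_mul, Finset.sum_mul]
    simp only [S.idem_mul_idem, Finset.sum_ite_eq', Finset.mem_Icc]
    split_ifs <;> simp
  -- The vertices left in `η_i x w` satisfy `i ≤ j` and lie outside `[i, l]`, hence `j ≰ l`. So `r`
  -- can be inserted after `w`, and it kills `y η_l`.
  obtain ⟨r, hr⟩ := S.exists_sum_idem fun j => ¬ j ≤ l
  have h1 : S.idem i * (x * w) = S.idem i * (x * w * r) := by
    refine S.ext_idem_right fun j => ?_
    have h0 : ¬ i ≤ j → S.idem i * x * S.idem j = 0 := S.idem_mul_mul_idem_of_not_le x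
    have e1 : S.idem i * (x * w) * S.idem j = S.idem i * x * (w * S.idem j) := by noncomm_ring
    have e2 : S.idem i * (x * w * r) * S.idem j = S.idem i * x * (w * (r * S.idem j)) := by
      noncomm_ring
    rw [e1, e2, (hr j).2]
    by_cases hjl : j ≤ l
    · by_cases hij : i ≤ j
      · simp [hjl, hwj, hij]
      · simp [hjl, hwj, hij, h0 hij]
    · simp [hjl]
  have h2 : r * y * S.idem l = 0 * S.idem l := by
    refine S.ext_idem_left fun j => ?_
    rw [← mul_assoc, (hr j).1]
    by_cases hjl : j ≤ l
    · simp [hjl]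
    · simp [hjl, S.idem_mul_mul_idem_of_not_le y hjl]
  have h3 : S.idem i * (x * w) * y * S.idem l = 0 := by
    have : S.idem i * (x * w * r) * y * S.idem l = S.idem i * (x * w) * (r * y * S.idem l) := by
      noncomm_ring
    rw [h1, this, h2, zero_mul, mul_zero]
  have h4 : ∑ j ∈ Finset.Icc i l, S.idem i * x * S.idem j * (S.idem j * y * S.idem l) =
      S.idem i * x * (∑ j ∈ Finset.Icc i l, S.idem j) * y * S.idem l := by
    rw [Finset.mul_sum, Finset.sum_mul, Finset.sum_mul]
    refine Finset.sum_congr rfl fun j _ => ?_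
    nth_rw 3 [← S.idem_mul_self j]
    noncomm_ring
  rw [h4, ← sub_eq_zero, ← h3, hw]
  noncomm_ring

/-- The structure constants of the lifted matrix units. -/
noncomputable def cocycle (i j l : P) : k⟦X⟧ :=
  (S.lead i l)⁻¹ * T.entries (S.unit i j * S.unit j l) i l

lemma unit_mul_unit {i j l : P} (hij : i ≤ j) (hjl : j ≤ l) :
    S.unit i j * S.unit j l = S.cocycle i j l • S.unit i l :=
  S.eq_smul_unit (hij.trans hjl) (by rw [← mul_assoc, S.idem_mul_unit])
    (by rw [mul_assoc, S.unit_mul_idem])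

lemma constantCoeff_cocycle {i j l : P} (hij : i ≤ j) (hjl : j ≤ l) :
    constantCoeff (S.cocycle i j l) = 1 := by
  rw [cocycle, map_mul, S.constantCoeff_inv_lead (hij.trans hjl), one_mul, ← T.red_apply, map_mul,
    S.red_unit hij, S.red_unit hjl, single_mul_single hij hjl,
    single_apply_self (hij.trans hjl)]

lemma smul_unit_injective {i j : P} (h : i ≤ j) {c d : k⟦X⟧} (hcd : c • S.unit i j = d • S.unit i j) :
    c = d := by
  have := congrArg (fun x => T.entries x i j) hcd
  simp only [T.entries_smul] at this
  have h0 : T.entries (S.unit i j) i j ≠ 0 := fun h0 =>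
    S.lead_ne h (by rw [lead, h0, map_zero])
  exact mul_right_cancel₀ h0 this

/-- Both sides are the coefficient of `v_{im}` in the associative product `v_{ij} v_{jl} v_{lm}`. -/
lemma cocycle_mul {i j l m : P} (hij : i ≤ j) (hjl : j ≤ l) (hlm : l ≤ m) :
    S.cocycle i j l * S.cocycle i l m = S.cocycle j l m * S.cocycle i j m := by
  apply S.smul_unit_injective (hij.trans (hjl.trans hlm))
  rw [mul_smul, mul_smul, ← S.unit_mul_unit (hij.trans hjl) hlm,
    ← S.unit_mul_unit hij (hjl.trans hlm), ← smul_mul_assoc, ← mul_smul_comm,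
    ← S.unit_mul_unit hij hjl, ← S.unit_mul_unit hjl hlm, mul_assoc]

lemma cocycle_left {i l : P} (h : i ≤ l) : S.cocycle i i l = 1 := by
  apply S.smul_unit_injective h
  rw [← S.unit_mul_unit le_rfl h, S.unit_self, S.idem_mul_unit, one_smul]

lemma cocycle_right {i l : P} (h : i ≤ l) : S.cocycle i l l = 1 := by
  apply S.smul_unit_injective h
  rw [← S.unit_mul_unit h le_rfl, S.unit_self, S.unit_mul_idem, one_smul]

/-- By locality only `η_i x η_j · η_j y η_l` with `j` in `[i, l]` contributes, and each such term is
a product of multiples of `v_{ij}` and `v_{jl}`. Thus `coord` is multiplicative towards the product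
twisted by `cocycle`. -/
lemma entries_coord_mul (x y : B) (i l : P) :
    T.entries (S.coord (x * y)) i l = ∑ j ∈ Finset.Icc i l,
      S.cocycle i j l * (T.entries (S.coord x) i j * T.entries (S.coord y) j l) := by
  by_cases hil : i ≤ l
  · apply S.smul_unit_injective hil
    rw [← S.idem_mul_mul_idem _ hil, S.idem_mul_mul_mul_idem, Finset.sum_smul]
    refine Finset.sum_congr rfl fun j hj => ?_
    obtain ⟨hij, hjl⟩ := Finset.mem_Icc.1 hj
    rw [S.idem_mul_mul_idem x hij, S.idem_mul_mul_idem y hjl, smul_mul_smul_comm,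
      S.unit_mul_unit hij hjl, smul_smul, mul_comm]
  · rw [apply_eq_zero_of_not_le hil, Finset.Icc_eq_empty hil, Finset.sum_empty]

end Frame
end IncidenceModel
end Frame

/-! ### Formal extensions of linear and bilinear maps. -/

section Extension

variable {k A : Type*} [Field k] [Ring A] [Algebra k A]

/-- `formalExtend₁ f` is linear over `k[[λ]]`. -/
lemma coeff_formalExtend₁_smul (f : ℕ → A →ₗ[k] A) (c : k⟦X⟧) {x z : A⟦X⟧}
    (hz : ∀ n, coeff n z = ∑ p ∈ Finset.HasAntidiagonal.antidiagonal n, coeff p.1 c • coeff p.2 x)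
    (n : ℕ) :
    coeff n (formalExtend₁ f z) = ∑ p ∈ Finset.HasAntidiagonal.antidiagonal n,
      coeff p.1 c • coeff p.2 (formalExtend₁ f x) := by
  simp only [formalExtend₁, coeff_mk, hz, map_sum, map_smul, Finset.smul_sum, Finset.sum_sigma']
  apply Finset.sum_nbij' (fun ⟨⟨a, _⟩, ⟨c, d⟩⟩ ↦ ⟨(c, a + d), (a, d)⟩)
    (fun ⟨⟨a, _⟩, ⟨c, d⟩⟩ ↦ ⟨(c, a + d), (a, d)⟩)
  all_goals
    rintro ⟨⟨a, b⟩, ⟨c, d⟩⟩ h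
    simp only [Finset.mem_sigma, Finset.HasAntidiagonal.mem_antidiagonal] at h
    obtain ⟨h1, h2⟩ := h
    subst h2
    subst h1
    simp [add_left_comm]

/-- Fixing one argument turns a bilinear extension into a linear one, so additivity and
`k[[λ]]`-linearity in each variable follow from the case of `formalExtend₁`. -/
lemma formalExtend₂_eq_left (F : ℕ → A →ₗ[k] A →ₗ[k] A) (x y : A⟦X⟧) :
    formalExtend₂ F x y = formalExtend₁ (fun n => ∑ p ∈ Finset.HasAntidiagonal.antidiagonal n,
      (F p.1).flip (coeff p.2 y)) x := by
  ext n
  simp only [formalExtend₁, formalExtend₂, coeff_mk, LinearMap.sum_apply, LinearMap.flip_apply,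
    Finset.sum_sigma']
  apply Finset.sum_nbij' (fun ⟨⟨a, _⟩, ⟨c, d⟩⟩ ↦ ⟨(a + d, c), (a, d)⟩)
    (fun ⟨⟨_, b⟩, ⟨c, d⟩⟩ ↦ ⟨(c, b + d), (b, d)⟩)
  all_goals
    rintro ⟨⟨a, b⟩, ⟨c, d⟩⟩ h
    simp only [Finset.mem_sigma, Finset.HasAntidiagonal.mem_antidiagonal] at h
    obtain ⟨h1, h2⟩ := h
    subst h2
    subst h1
    simp [add_assoc, add_comm d]

lemma formalExtend₂_eq_right (F : ℕ → A →ₗ[k] A →ₗ[k] A) (x y : A⟦X⟧) :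
    formalExtend₂ F x y = formalExtend₁ (fun n => ∑ p ∈ Finset.HasAntidiagonal.antidiagonal n,
      F p.1 (coeff p.2 x)) y := by
  ext n
  simp only [formalExtend₁, formalExtend₂, coeff_mk, LinearMap.sum_apply, Finset.sum_sigma']
  apply Finset.sum_nbij' (fun ⟨⟨a, _⟩, ⟨c, d⟩⟩ ↦ ⟨(a + c, d), (a, c)⟩)
    (fun ⟨⟨_, b⟩, ⟨c, d⟩⟩ ↦ ⟨(c, d + b), (d, b)⟩)
  all_goals
    rintro ⟨⟨a, b⟩, ⟨c, d⟩⟩ h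
    simp only [Finset.mem_sigma, Finset.HasAntidiagonal.mem_antidiagonal] at h
    obtain ⟨h1, h2⟩ := h
    subst h2
    subst h1
    simp [add_assoc]

lemma formalExtend₁_add (f : ℕ → A →ₗ[k] A) (x y : A⟦X⟧) :
    formalExtend₁ f (x + y) = formalExtend₁ f x + formalExtend₁ f y := by
  ext n
  simp [formalExtend₁, Finset.sum_add_distrib]

lemma coeff_zero_formalExtend₁ (f : ℕ → A →ₗ[k] A) (x : A⟦X⟧) :
    coeff 0 (formalExtend₁ f x) = f 0 (coeff 0 x) := by
  simp [formalExtend₁]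

lemma coeff_zero_formalExtend₂ (F : ℕ → A →ₗ[k] A →ₗ[k] A) (x y : A⟦X⟧) :
    coeff 0 (formalExtend₂ F x y) = F 0 (coeff 0 x) (coeff 0 y) := by
  simp [formalExtend₂]

lemma coeff_formalExtend₂_C (F : ℕ → A →ₗ[k] A →ₗ[k] A) (a b : A) (n : ℕ) :
    coeff n (formalExtend₂ F (C a) (C b)) = F n a b := by
  simp only [formalExtend₂, coeff_mk]
  rw [Finset.sum_eq_single (n, 0)]
  · simp
  · rintro ⟨p, q⟩ h hne
    have hq : q ≠ 0 := by
      rintro rfl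
      simp_all
    refine Finset.sum_eq_zero ?_
    rintro ⟨r, s⟩ hrs
    simp only [Finset.HasAntidiagonal.mem_antidiagonal] at hrs
    by_cases hr : r = 0
    · have hs : s ≠ 0 := by omega
      simp [coeff_C, hs]
    · simp [coeff_C, hr]
  · simp

/-- The unit axiom on constants says that `F_n(1, ·)` is zero for `n > 0`; only the `F_0` term
survives on a series. -/
lemma FormalDeformation.one_mul_series (F : FormalDeformation k A) (x : A⟦X⟧) :
    F.mul (C 1) x = x := by
  have h : ∀ n, F.term n 1 = if n = 0 then LinearMap.id else 0 := by
    intro n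
    ext a
    rw [← coeff_formalExtend₂_C, F.one_left, coeff_C]
    split_ifs <;> rfl
  ext n
  rw [mul, formalExtend₂_eq_right]
  simp only [formalExtend₁, coeff_mk]
  rw [Finset.sum_eq_single (0, n)]
  · simp [h]
  · rintro ⟨p, q⟩ hpq hne
    rw [Finset.sum_eq_zero, LinearMap.zero_apply]
    rintro ⟨r, s⟩ hrs
    simp only [Finset.HasAntidiagonal.mem_antidiagonal] at hpq hrs
    by_cases hr : r = 0
    · have hs : s ≠ 0 := by
        rintro rfl
        apply hne
        simp only [Prod.mk.injEq]
        omega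
      simp [hs]
    · by_cases hs : s = 0
      · simp [hs, h, hr]
      · simp [hs]
  · simp

lemma FormalDeformation.mul_one_series (F : FormalDeformation k A) (x : A⟦X⟧) :
    F.mul x (C 1) = x := by
  have h : ∀ n, (F.term n).flip 1 = if n = 0 then LinearMap.id else 0 := by
    intro n
    ext a
    rw [LinearMap.flip_apply, ← coeff_formalExtend₂_C, F.one_right, coeff_C]
    split_ifs <;> rfl
  ext n
  rw [mul, formalExtend₂_eq_left]
  simp only [formalExtend₁, coeff_mk]
  rw [Finset.sum_eq_single (0, n)]
  · simp [h]
  · rintro ⟨p, q⟩ hpq hne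
    rw [Finset.sum_eq_zero, LinearMap.zero_apply]
    rintro ⟨r, s⟩ hrs
    simp only [Finset.HasAntidiagonal.mem_antidiagonal] at hpq hrs
    by_cases hr : r = 0
    · have hs : s ≠ 0 := by
        rintro rfl
        apply hne
        simp only [Prod.mk.injEq]
        omega
      simp [hs]
    · by_cases hs : s = 0
      · simp [hs, h, hr]
      · simp [hs]
  · simp

end Extension

/-! ### The deformed algebra, and equivalences as `k[[λ]]`-linear maps. -/

section Algebra

variable {k P : Type*} [Field k] [PartialOrder P] [LocallyFiniteOrder P] [DecidableEq P]

/-- Incidence matrices over `k[[λ]]` as power series with coefficients in the incidence algebra. -/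
noncomputable def IncidenceAlgebra.toSeries :
    IncidenceAlgebra k⟦X⟧ P ≃+ (IncidenceAlgebra k P)⟦X⟧ where
  toFun x := PowerSeries.mk fun n => ⟨fun i j => coeff n (x i j), fun i j h => by
    rw [apply_eq_zero_of_not_le h, map_zero]⟩
  invFun y := ⟨fun i j => PowerSeries.mk fun n => coeff n y i j, fun i j h => by
    ext n
    rw [coeff_mk, apply_eq_zero_of_not_le h, map_zero]⟩
  left_inv x := by
    ext i j _ n
    simp
  right_inv y := by
    ext n i j
    simp
  map_add' x y := by
    ext n i j
    simp

lemma IncidenceAlgebra.coeff_toSeries (x : IncidenceAlgebra k⟦X⟧ P) (n : ℕ) (i j : P) :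
    coeff n (toSeries x) i j = coeff n (x i j) := by
  simp [toSeries]

lemma IncidenceAlgebra.coeff_toSeries_symm (y : (IncidenceAlgebra k P)⟦X⟧) (n : ℕ) (i j : P) :
    coeff n (toSeries.symm y i j) = coeff n y i j := by
  rw [← coeff_toSeries, AddEquiv.apply_symm_apply]

lemma IncidenceAlgebra.coeff_toSeries_smul (c : k⟦X⟧) (x : IncidenceAlgebra k⟦X⟧ P) (n : ℕ) :
    coeff n (toSeries (c • x)) = ∑ p ∈ Finset.HasAntidiagonal.antidiagonal n,
      coeff p.1 c • coeff p.2 (toSeries x) := by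
  ext i j _
  have h : ∀ s : Finset (ℕ × ℕ), (∑ p ∈ s, coeff p.1 c • coeff p.2 (toSeries x)) i j =
      ∑ p ∈ s, coeff p.1 c * coeff p.2 (x i j) := by
    intro s
    induction s using Finset.induction_on with
    | empty => simp
    | insert a s ha ih =>
      rw [Finset.sum_insert ha, Finset.sum_insert ha, add_apply, ih, constSMul_apply,
        coeff_toSeries, smul_eq_mul]
  rw [h, coeff_toSeries, constSMul_apply, smul_eq_mul, coeff_mul]

lemma IncidenceAlgebra.formalExtend₁_smul (f : ℕ → Module.End k (IncidenceAlgebra k P)) (c : k⟦X⟧)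
    (x : IncidenceAlgebra k⟦X⟧ P) : toSeries.symm (formalExtend₁ f (toSeries (c • x))) =
      c • toSeries.symm (formalExtend₁ f (toSeries x)) := by
  apply (toSeries (k := k) (P := P)).injective
  ext1 n
  rw [AddEquiv.apply_symm_apply, coeff_formalExtend₁_smul f c (coeff_toSeries_smul c x),
    coeff_toSeries_smul, AddEquiv.apply_symm_apply]

namespace FormalDeformation

/-- The deformed algebra `(A[[λ]], F)`, on the module of incidence matrices over `k[[λ]]`. -/
def Alg (_F : FormalDeformation k (IncidenceAlgebra k P)) : Type _ := IncidenceAlgebra k⟦X⟧ P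

variable (F F' : FormalDeformation k (IncidenceAlgebra k P))

noncomputable instance : AddCommGroup F.Alg := inferInstanceAs (AddCommGroup (IncidenceAlgebra k⟦X⟧ P))

noncomputable instance : Module k⟦X⟧ F.Alg := inferInstanceAs (Module k⟦X⟧ (IncidenceAlgebra k⟦X⟧ P))

/-- The matrix of entries of an element of the deformed algebra. -/
noncomputable def entries : F.Alg ≃ₗ[k⟦X⟧] IncidenceAlgebra k⟦X⟧ P := LinearEquiv.refl _ _

/-- The deformed algebra as a module of power series. -/
noncomputable def series : F.Alg ≃+ (IncidenceAlgebra k P)⟦X⟧ :=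
  F.entries.toAddEquiv.trans toSeries

lemma coeff_series (x : F.Alg) (n : ℕ) (i j : P) :
    coeff n (F.series x) i j = coeff n (F.entries x i j) :=
  coeff_toSeries _ _ _ _

lemma series_symm_formalExtend₁_smul (f : ℕ → Module.End k (IncidenceAlgebra k P)) (c : k⟦X⟧)
    (x : F'.Alg) : F.series.symm (formalExtend₁ f (F'.series (c • x))) =
      c • F.series.symm (formalExtend₁ f (F'.series x)) :=
  formalExtend₁_smul f c x

noncomputable instance : Mul F.Alg := ⟨fun x y => F.series.symm (F.mul (F.series x) (F.series y))⟩

noncomputable instance : One F.Alg := ⟨F.series.symm (C 1)⟩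

lemma series_mul (x y : F.Alg) : F.series (x * y) = F.mul (F.series x) (F.series y) :=
  F.series.apply_symm_apply _

lemma series_one : F.series 1 = C 1 := F.series.apply_symm_apply _

noncomputable instance : Ring F.Alg where
  __ := (inferInstance : AddCommGroup F.Alg)
  left_distrib x y z := F.series.injective <| by
    simp only [series_mul, map_add, mul, formalExtend₂_eq_right, formalExtend₁_add]
  right_distrib x y z := F.series.injective <| by
    simp only [series_mul, map_add, mul, formalExtend₂_eq_left, formalExtend₁_add]
  zero_mul x := F.series.injective <| by
    rw [series_mul, map_zero, mul]
    ext1 n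
    simp [formalExtend₂]
  mul_zero x := F.series.injective <| by
    rw [series_mul, map_zero, mul]
    ext1 n
    simp [formalExtend₂]
  mul_assoc x y z := F.series.injective <| by
    simp only [series_mul]
    exact F.assoc _ _ _
  one_mul x := F.series.injective <| by
    rw [series_mul, series_one, one_mul_series]
  mul_one x := F.series.injective <| by
    rw [series_mul, series_one, mul_one_series]

noncomputable instance : Algebra k⟦X⟧ F.Alg := Algebra.ofModule
  (fun c x y => F.series.injective <| by
    apply F.series.symm.injective
    rw [series_mul, mul, formalExtend₂_eq_left, series_symm_formalExtend₁_smul,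
      ← formalExtend₂_eq_left, ← mul, ← series_mul, AddEquiv.symm_apply_apply,
      AddEquiv.symm_apply_apply])
  (fun c x y => F.series.injective <| by
    apply F.series.symm.injective
    rw [series_mul, mul, formalExtend₂_eq_right, series_symm_formalExtend₁_smul,
      ← formalExtend₂_eq_right, ← mul, ← series_mul, AddEquiv.symm_apply_apply,
      AddEquiv.symm_apply_apply])

/-- The deformed algebra as an algebra of incidence matrices. -/
noncomputable def model : IncidenceModel k P F.Alg where
  entries := F.entries
  red :=
    { toFun := fun x => coeff 0 (F.series x)
      map_one' := by rw [series_one, coeff_zero_C]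
      map_mul' := fun x y => by
        rw [series_mul, mul, coeff_zero_formalExtend₂, F.term_zero]
      map_zero' := by rw [map_zero, map_zero]
      map_add' := fun x y => by rw [map_add, map_add] }
  red_apply x i j := by
    rw [← coeff_zero_eq_constantCoeff_apply]
    exact F.coeff_series x 0 i j

lemma red_eq (x : F.Alg) : F.model.red x = coeff 0 (F.series x) := rfl

variable {F F'} in
lemma Equivalent.exists_linearMap (h : F.Equivalent F') : ∃ f : F'.Alg →ₗ[k⟦X⟧] F.Alg,
    (∀ x y, f (x * y) = f x * f y) ∧ ∀ x, F.model.red (f x) = F'.model.red x := by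
  obtain ⟨f, h0, -, hmul⟩ := h
  refine ⟨{ toFun := fun x => F.series.symm (formalExtend₁ f (F'.series x)),
            map_add' := fun x y => by rw [map_add, formalExtend₁_add, map_add],
            map_smul' := series_symm_formalExtend₁_smul F F' f }, fun x y => ?_, fun x => ?_⟩
  · apply F.series.injective
    simp only [LinearMap.coe_mk, AddHom.coe_mk, series_mul, AddEquiv.apply_symm_apply]
    exact hmul _ _
  · simp only [LinearMap.coe_mk, AddHom.coe_mk, red_eq, AddEquiv.apply_symm_apply]
    rw [coeff_zero_formalExtend₁, h0, LinearMap.id_apply]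

-- The components `f_n` are read off from the values of `f` on constants. Bijectivity comes for
-- free, since `f` is the identity modulo `λ`.
variable {F F'} in
lemma equivalent_of_linearMap (f : F'.Alg →ₗ[k⟦X⟧] F.Alg) (hmul : ∀ x y, f (x * y) = f x * f y)
    (hred : ∀ x, F.model.red (f x) = F'.model.red x) : F.Equivalent F' := by
  let f₁ : ℕ → IncidenceAlgebra k P →ₗ[k] IncidenceAlgebra k P := fun n =>
    { toFun := fun a => coeff n (F.series (f (F'.series.symm (C a))))
      map_add' := fun a b => by simp only [map_add]
      map_smul' := fun c a => by
        have h : F'.series.symm (C (c • a)) = (C c : k⟦X⟧) • F'.series.symm (C a) := by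
          apply F'.entries.injective
          ext i j _ n
          rw [map_smul F'.entries, constSMul_apply, smul_eq_mul, coeff_C_mul, ← coeff_series,
            ← coeff_series,
            AddEquiv.apply_symm_apply, AddEquiv.apply_symm_apply, coeff_C, coeff_C]
          split_ifs
          · rw [constSMul_apply, smul_eq_mul]
          · rw [IncidenceAlgebra.zero_apply, mul_zero]
        ext i j _
        rw [h, map_smul, coeff_series, map_smul, constSMul_apply, smul_eq_mul, coeff_C_mul,
          RingHom.id_apply, constSMul_apply, coeff_series, smul_eq_mul] }
  -- A `k[[λ]]`-linear map is determined by its values on constants: split `x = x_0 + λy` and use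
  -- induction on the coefficient. No continuity has to be assumed.
  have key : ∀ n x, coeff n (F.series (f x)) = coeff n (formalExtend₁ f₁ (F'.series x)) := by
    intro n
    induction n with
    | zero =>
      intro x
      rw [coeff_zero_formalExtend₁]
      change F.model.red (f x) = F.model.red (f (F'.series.symm (C (coeff 0 (F'.series x)))))
      rw [hred, hred, red_eq, red_eq, AddEquiv.apply_symm_apply, coeff_zero_C]
    | succ n ih =>
      intro x
      obtain ⟨y, hy⟩ := F'.model.exists_X_smul (x := x - F'.series.symm (C (coeff 0 (F'.series x))))
        (by rw [map_sub, red_eq, red_eq, AddEquiv.apply_symm_apply, coeff_zero_C, sub_self])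
      have hX : ∀ (G : FormalDeformation k (IncidenceAlgebra k P)) (z : G.Alg) (m : ℕ),
          coeff (m + 1) (G.series ((X : k⟦X⟧) • z)) = coeff m (G.series z) := by
        intro G z m
        ext i j _
        rw [coeff_series, map_smul, constSMul_apply, smul_eq_mul, coeff_succ_X_mul, coeff_series]
      have hx : x = F'.series.symm (C (coeff 0 (F'.series x))) + (X : k⟦X⟧) • y := by
        rw [← hy]; abel
      have hx' : ∀ m, coeff (m + 1) (F'.series x) = coeff m (F'.series y) := by
        intro m
        rw [← hX F' y, ← hy, map_sub, map_sub, AddEquiv.apply_symm_apply, coeff_C, if_neg m.succ_ne_zero,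
          sub_zero]
      conv_lhs => rw [hx]
      rw [map_add, map_smul, map_add, map_add, hX, ih, formalExtend₁, coeff_mk, formalExtend₁,
        coeff_mk, Finset.Nat.sum_antidiagonal_succ']
      simp only [hx']
      rfl
  have key' : ∀ x, formalExtend₁ f₁ x = F.series (f (F'.series.symm x)) := fun x => by
    ext1 n
    rw [key, AddEquiv.apply_symm_apply]
  have hbij : Function.Bijective f := by
    let g : F'.Alg →ₗ[k⟦X⟧] F'.Alg := (F.entries.trans F'.entries.symm).toLinearMap ∘ₗ f
    have hg : Function.Bijective g := F'.model.bijective_of_red fun x => by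
      rw [← hred x]
      rfl
    have : ⇑f = (F.entries.trans F'.entries.symm).symm ∘ g := by
      funext x
      simp [g]
    rw [this]
    exact (LinearEquiv.bijective _).comp hg
  refine ⟨f₁, ?_, ?_, fun x y => ?_⟩
  · ext1 a
    change F.model.red (f (F'.series.symm (C a))) = a
    rw [hred, red_eq, AddEquiv.apply_symm_apply, coeff_zero_C]
  · rw [show formalExtend₁ f₁ = F.series ∘ f ∘ F'.series.symm from funext key']
    exact F.series.bijective.comp (hbij.comp F'.series.symm.bijective)
  · rw [key', key', key', ← series_mul, ← hmul]
    congr 2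
    apply F'.series.injective
    rw [series_mul, AddEquiv.apply_symm_apply, AddEquiv.apply_symm_apply, AddEquiv.apply_symm_apply]

end FormalDeformation
end Algebra

/-! ### Witt vector valued cochains as functions on triples. -/

section Witt

variable {k : Type*} [Field k]

lemma BigWittGroup.constantCoeff_coe (c : BigWittGroup k) :
    constantCoeff ((c : k⟦X⟧ˣ) : k⟦X⟧) = 1 :=
  congrArg Units.val (MonoidHom.mem_ker.1 c.2)

lemma BigWittGroup.ext {c d : BigWittGroup k} (h : ((c : k⟦X⟧ˣ) : k⟦X⟧) = ((d : k⟦X⟧ˣ) : k⟦X⟧)) :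
    c = d :=
  Subtype.ext (Units.ext h)

lemma BigWittGroup.exists_coe {c : k⟦X⟧} (h : constantCoeff c = 1) :
    ∃ w : BigWittGroup k, ((w : k⟦X⟧ˣ) : k⟦X⟧) = c := by
  have h0 : constantCoeff c ≠ 0 := by rw [h]; exact one_ne_zero
  refine ⟨⟨⟨c, c⁻¹, PowerSeries.mul_inv_cancel c h0, PowerSeries.inv_mul_cancel c h0⟩, ?_⟩, rfl⟩
  rw [MonoidHom.mem_ker]
  exact Units.ext h

end Witt

section Cochain

variable {k P G : Type*} [Field k] [PartialOrder P] [CommGroup G]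

/-- The edge `i ≤ j`. -/
def simplex₁ {i j : P} (hij : i ≤ j) : Fin 2 →o P where
  toFun := ![i, j]
  monotone' := by
    rw [Fin.monotone_iff_le_succ]
    intro x
    fin_cases x
    simpa

/-- The `3`-simplex `i ≤ j ≤ l ≤ m`. -/
def simplex₃ {i j l m : P} (hij : i ≤ j) (hjl : j ≤ l) (hlm : l ≤ m) : Fin 4 →o P where
  toFun := ![i, j, l, m]
  monotone' := by
    rw [Fin.monotone_iff_le_succ]
    intro x
    fin_cases x <;> simpa

lemma posetCoboundary_one_apply (φ : PosetCochain P G 1) {i j l : P} (hij : i ≤ j) (hjl : j ≤ l) :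
    posetCoboundary P G 1 φ (simplex₂ hij hjl) =
      φ (simplex₁ hjl) * (φ (simplex₁ (hij.trans hjl)))⁻¹ * φ (simplex₁ hij) := by
  have h0 : simplexFace 0 (simplex₂ hij hjl) = simplex₁ hjl := by
    ext x; fin_cases x <;> rfl
  have h1 : simplexFace 1 (simplex₂ hij hjl) = simplex₁ (hij.trans hjl) := by
    ext x; fin_cases x <;> rfl
  have h2 : simplexFace 2 (simplex₂ hij hjl) = simplex₁ hij := by
    ext x; fin_cases x <;> rfl
  change ∏ a : Fin 3, φ (simplexFace a (simplex₂ hij hjl)) ^ ((-1 : ℤ) ^ (a : ℕ)) = _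
  rw [Fin.prod_univ_three, h0, h1, h2]
  simp

lemma posetCoboundary_two_apply (ω : PosetCochain P G 2) {i j l m : P} (hij : i ≤ j) (hjl : j ≤ l)
    (hlm : l ≤ m) : posetCoboundary P G 2 ω (simplex₃ hij hjl hlm) =
      ω (simplex₂ hjl hlm) * (ω (simplex₂ (hij.trans hjl) hlm))⁻¹ *
        ω (simplex₂ hij (hjl.trans hlm)) * (ω (simplex₂ hij hjl))⁻¹ := by
  have h0 : simplexFace 0 (simplex₃ hij hjl hlm) = simplex₂ hjl hlm := by
    ext x; fin_cases x <;> rfl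
  have h1 : simplexFace 1 (simplex₃ hij hjl hlm) = simplex₂ (hij.trans hjl) hlm := by
    ext x; fin_cases x <;> rfl
  have h2 : simplexFace 2 (simplex₃ hij hjl hlm) = simplex₂ hij (hjl.trans hlm) := by
    ext x; fin_cases x <;> rfl
  have h3 : simplexFace 3 (simplex₃ hij hjl hlm) = simplex₂ hij hjl := by
    ext x; fin_cases x <;> rfl
  change ∏ a : Fin 4, ω (simplexFace a (simplex₃ hij hjl hlm)) ^ ((-1 : ℤ) ^ (a : ℕ)) = _
  rw [Fin.prod_univ_four, h0, h1, h2, h3]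
  simp [pow_succ]

lemma exists_eq_simplex₂ (v : Fin 3 →o P) :
    ∃ (i j l : P) (hij : i ≤ j) (hjl : j ≤ l), v = simplex₂ hij hjl :=
  ⟨v 0, v 1, v 2, v.monotone (by decide), v.monotone (by decide), by
    ext x; fin_cases x <;> rfl⟩

lemma exists_eq_simplex₃ (v : Fin 4 →o P) :
    ∃ (i j l m : P) (hij : i ≤ j) (hjl : j ≤ l) (hlm : l ≤ m), v = simplex₃ hij hjl hlm :=
  ⟨v 0, v 1, v 2, v 3, v.monotone (by decide), v.monotone (by decide), v.monotone (by decide), by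
    ext x; fin_cases x <;> rfl⟩

/-- `w` consists of the values of the Witt vector valued `2`-cochain `ω`. -/
def HasValues (ω : PosetCochain P (BigWittGroup k) 2) (w : P → P → P → k⟦X⟧) : Prop :=
  ∀ ⦃i j l : P⦄ (hij : i ≤ j) (hjl : j ≤ l), ((ω (simplex₂ hij hjl) : k⟦X⟧ˣ) : k⟦X⟧) = w i j l

/-- The cocycle condition for a function of triples `i ≤ j ≤ l`. -/
def IsCocycleFun (w : P → P → P → k⟦X⟧) : Prop :=
  ∀ ⦃i j l m : P⦄, i ≤ j → j ≤ l → l ≤ m → w i j l * w i l m = w j l m * w i j m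

lemma exists_hasValues (ω : PosetCochain P (BigWittGroup k) 2) : ∃ w, HasValues ω w := by
  classical
  -- Total functions avoid carrying order proofs; the value off chains is never used.
  refine ⟨fun i j l => if h : i ≤ j ∧ j ≤ l then ((ω (simplex₂ h.1 h.2) : k⟦X⟧ˣ) : k⟦X⟧) else 0,
    fun i j l hij hjl => ?_⟩
  simp [hij, hjl]

lemma HasValues.constantCoeff {ω : PosetCochain P (BigWittGroup k) 2} {w : P → P → P → k⟦X⟧}
    (h : HasValues ω w) {i j l : P} (hij : i ≤ j) (hjl : j ≤ l) :
    constantCoeff (w i j l) = 1 := by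
  rw [← h hij hjl, BigWittGroup.constantCoeff_coe]

lemma HasValues.ne_zero {ω : PosetCochain P (BigWittGroup k) 2} {w : P → P → P → k⟦X⟧}
    (h : HasValues ω w) {i j l : P} (hij : i ≤ j) (hjl : j ≤ l) : w i j l ≠ 0 := by
  intro h0
  have := h.constantCoeff hij hjl
  rw [h0, map_zero] at this
  exact zero_ne_one this

lemma HasValues.mem_Z2_iff {ω : PosetCochain P (BigWittGroup k) 2} {w : P → P → P → k⟦X⟧}
    (h : HasValues ω w) : ω ∈ PosetZ2 P (BigWittGroup k) ↔ IsCocycleFun w := by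
  have key : ∀ {i j l m : P} (hij : i ≤ j) (hjl : j ≤ l) (hlm : l ≤ m),
      posetCoboundary P (BigWittGroup k) 2 ω (simplex₃ hij hjl hlm) = 1 ↔
        w i j l * w i l m = w j l m * w i j m := by
    intro i j l m hij hjl hlm
    rw [posetCoboundary_two_apply, mul_inv_eq_one, mul_right_comm, mul_inv_eq_iff_eq_mul,
      ← h hij hjl, ← h hjl hlm, ← h (hij.trans hjl) hlm, ← h hij (hjl.trans hlm)]
    constructor
    · intro hh
      simp only [← Units.val_mul, ← Subgroup.coe_mul, hh]
    · intro hh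
      apply BigWittGroup.ext
      simpa only [Units.val_mul, Subgroup.coe_mul] using hh.symm
  rw [MonoidHom.mem_ker]
  constructor
  · intro hω i j l m hij hjl hlm
    rw [← key hij hjl hlm, hω, Pi.one_apply]
  · intro hw
    funext v
    obtain ⟨i, j, l, m, hij, hjl, hlm, rfl⟩ := exists_eq_simplex₃ v
    rw [Pi.one_apply, key]
    exact hw hij hjl hlm

lemma exists_Z2_of_isCocycleFun {w : P → P → P → k⟦X⟧}
    (h1 : ∀ i j l, i ≤ j → j ≤ l → constantCoeff (w i j l) = 1) (hw : IsCocycleFun w) :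
    ∃ ω : PosetZ2 P (BigWittGroup k), HasValues ω.1 w := by
  choose! ω hω using fun v : Fin 3 →o P =>
    BigWittGroup.exists_coe (h1 (v 0) (v 1) (v 2) (v.monotone (by decide)) (v.monotone (by decide)))
  have h : HasValues ω w := fun i j l hij hjl => hω _
  exact ⟨⟨ω, h.mem_Z2_iff.2 hw⟩, h⟩

/-- Two cocycles are cohomologous iff their values differ by a coboundary. -/
lemma mk_eq_mk_iff {ω ω' : PosetZ2 P (BigWittGroup k)} {w w' : P → P → P → k⟦X⟧}
    (h : HasValues ω.1 w) (h' : HasValues ω'.1 w') :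
    (QuotientGroup.mk ω : PosetH2 P (BigWittGroup k)) = QuotientGroup.mk ω' ↔
      ∃ φ : P → P → k⟦X⟧, (∀ i j, i ≤ j → constantCoeff (φ i j) = 1) ∧
        ∀ i j l, i ≤ j → j ≤ l → w' i j l * φ i l = w i j l * (φ i j * φ j l) := by
  rw [QuotientGroup.eq, Subgroup.mem_subgroupOf, MonoidHom.mem_range]
  have key : ∀ (φ : PosetCochain P (BigWittGroup k) 1) {i j l : P} (hij : i ≤ j) (hjl : j ≤ l),
      posetCoboundary P (BigWittGroup k) 1 φ (simplex₂ hij hjl) =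
        (ω⁻¹ * ω').1 (simplex₂ hij hjl) ↔
      w' i j l * ((φ (simplex₁ (hij.trans hjl)) : k⟦X⟧ˣ) : k⟦X⟧) =
        w i j l * (((φ (simplex₁ hij) : k⟦X⟧ˣ) : k⟦X⟧) * ((φ (simplex₁ hjl) : k⟦X⟧ˣ) : k⟦X⟧)) := by
    intro φ i j l hij hjl
    have e : (ω⁻¹ * ω').1 (simplex₂ hij hjl) =
      (ω.1 (simplex₂ hij hjl))⁻¹ * ω'.1 (simplex₂ hij hjl) := rfl
    rw [posetCoboundary_one_apply, mul_right_comm, mul_inv_eq_iff_eq_mul, e, mul_assoc,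
      eq_inv_mul_iff_mul_eq, ← h hij hjl, ← h' hij hjl, mul_comm (φ (simplex₁ hjl))]
    constructor
    · intro hh
      simp only [← Units.val_mul, ← Subgroup.coe_mul, hh]
    · intro hh
      apply BigWittGroup.ext
      simpa only [Units.val_mul, Subgroup.coe_mul] using hh.symm
  constructor
  · rintro ⟨φ, hφ⟩
    classical
    refine ⟨fun i j => if hij : i ≤ j then ((φ (simplex₁ hij) : k⟦X⟧ˣ) : k⟦X⟧) else 0, ?_, ?_⟩
    · intro i j hij
      simp only [hij, dif_pos, BigWittGroup.constantCoeff_coe]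
    · intro i j l hij hjl
      simp only [hij, hjl, hij.trans hjl, dif_pos]
      rw [← key φ hij hjl, hφ]
  · rintro ⟨φ, h1, hφ⟩
    choose ψ hψ using fun v : Fin 2 →o P =>
      BigWittGroup.exists_coe (h1 (v 0) (v 1) (v.monotone (by decide)))
    refine ⟨ψ, ?_⟩
    funext v
    obtain ⟨i, j, l, hij, hjl, rfl⟩ := exists_eq_simplex₂ v
    refine (key ψ hij hjl).2 ?_
    rw [hψ, hψ, hψ]
    exact hφ i j l hij hjl

/-- Every cohomology class contains a normalized cocycle. -/
lemma exists_normalized (c : PosetH2 P (BigWittGroup k)) :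
    ∃ (ω : PosetZ2 P (BigWittGroup k)) (w : P → P → P → k⟦X⟧), QuotientGroup.mk ω = c ∧
      HasValues ω.1 w ∧ (∀ i l, i ≤ l → w i i l = 1) ∧ ∀ i l, i ≤ l → w i l l = 1 := by
  obtain ⟨ω₀, rfl⟩ := QuotientGroup.mk_surjective c
  obtain ⟨w₀, h₀⟩ := exists_hasValues ω₀.1
  have hc := h₀.mem_Z2_iff.1 ω₀.2
  -- The cocycle identity on `(i, i, i, l)`, and below on `(i, l, l, l)`, shows that degenerate
  -- values depend on the repeated vertex only.
  have hleft : ∀ i l, i ≤ l → w₀ i i l = w₀ i i i := fun i l hil =>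
    (mul_right_cancel₀ (h₀.ne_zero le_rfl hil) (hc (le_refl i) (le_refl i) hil)).symm
  have hright : ∀ i l, i ≤ l → w₀ i l l = w₀ l l l := fun i l hil =>
    mul_right_cancel₀ (h₀.ne_zero hil le_rfl) (hc hil (le_refl l) (le_refl l))
  have hne : ∀ i, constantCoeff (w₀ i i i) ≠ 0 := fun i => by
    rw [h₀.constantCoeff le_rfl le_rfl]; exact one_ne_zero
  have hinv : ∀ i, w₀ i i i * (w₀ i i i)⁻¹ = 1 := fun i => PowerSeries.mul_inv_cancel _ (hne i)
  -- divide by the coboundary of `(i, l) ↦ w₀ i i i`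
  let w : P → P → P → k⟦X⟧ := fun i j l => w₀ i j l * (w₀ j j j)⁻¹
  obtain ⟨ω, hω⟩ := exists_Z2_of_isCocycleFun (w := w)
    (fun i j l hij hjl => by
      rw [map_mul, h₀.constantCoeff hij hjl, constantCoeff_inv, h₀.constantCoeff le_rfl le_rfl,
        inv_one, one_mul])
    (fun i j l m hij hjl hlm => by
      change w₀ i j l * _ * (w₀ i l m * _) = w₀ j l m * _ * (w₀ i j m * _)
      rw [mul_mul_mul_comm, hc hij hjl hlm]
      ring)
  refine ⟨ω, w, ?_, hω, fun i l hil => ?_, fun i l hil => ?_⟩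
  · rw [mk_eq_mk_iff hω h₀]
    refine ⟨fun i _ => w₀ i i i, fun i j _ => h₀.constantCoeff le_rfl le_rfl, ?_⟩
    intro i j l hij hjl
    change _ = w₀ i j l * _ * _
    linear_combination (-(w₀ i j l * w₀ i i i)) * hinv j
  · change w₀ i i l * _ = 1
    rw [hleft i l hil, hinv]
  · change w₀ i l l * _ = 1
    rw [hright i l hil, hinv]

end Cochain

/-! ### Deformations given by cocycles and their equivalences. -/

section Cocycle

variable {k P : Type*} [Field k] [PartialOrder P] [LocallyFiniteOrder P] [DecidableEq P]

/-- The bilinear maps `(a, b) ↦ ∑_{i ≤ j ≤ l} w(i, j, l) a(i, j) b(j, l)`. -/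
noncomputable def twistedMul (w : P → P → P → k) :
    IncidenceAlgebra k P →ₗ[k] IncidenceAlgebra k P →ₗ[k] IncidenceAlgebra k P :=
  LinearMap.mk₂ k (fun a b => ⟨fun i l => ∑ j ∈ Finset.Icc i l, w i j l * (a i j * b j l),
      fun i l h => by rw [Finset.Icc_eq_empty h, Finset.sum_empty]⟩)
    (fun a a' b => by
      ext i l _
      simp [add_mul, mul_add, Finset.sum_add_distrib])
    (fun c a b => by
      ext i l _
      simp only [coe_mk, constSMul_apply, smul_eq_mul, Finset.mul_sum]
      exact Finset.sum_congr rfl fun j _ => by ring)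
    (fun a b b' => by
      ext i l _
      simp [mul_add, Finset.sum_add_distrib])
    (fun c a b => by
      ext i l _
      simp only [coe_mk, constSMul_apply, smul_eq_mul, Finset.mul_sum]
      exact Finset.sum_congr rfl fun j _ => by ring)

omit [DecidableEq P] in
lemma twistedMul_apply (w : P → P → P → k) (a b : IncidenceAlgebra k P) (i l : P) :
    twistedMul w a b i l = ∑ j ∈ Finset.Icc i l, w i j l * (a i j * b j l) := rfl

omit [LocallyFiniteOrder P] [DecidableEq P] in
lemma IncidenceAlgebra.sum_apply {ι : Type*} (s : Finset ι) (f : ι → IncidenceAlgebra k P)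
    (i j : P) : (∑ a ∈ s, f a) i j = ∑ a ∈ s, f a i j := by
  classical
  induction s using Finset.induction_on with
  | empty => simp
  | insert a s ha ih => rw [Finset.sum_insert ha, Finset.sum_insert ha, add_apply, ih]

lemma toSeries_symm_formalExtend₂ {F : ℕ → IncidenceAlgebra k P →ₗ[k] IncidenceAlgebra k P →ₗ[k]
      IncidenceAlgebra k P} {w : P → P → P → k⟦X⟧}
    (hF : ∀ n a b i l, F n a b i l =
      ∑ j ∈ Finset.Icc i l, coeff n (w i j l) * (a i j * b j l))
    (x y : IncidenceAlgebra k⟦X⟧ P) (i l : P) :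
    toSeries.symm (formalExtend₂ F (toSeries x) (toSeries y)) i l =
      ∑ j ∈ Finset.Icc i l, w i j l * (x i j * y j l) := by
  ext n
  rw [coeff_toSeries_symm, formalExtend₂, coeff_mk, map_sum]
  simp only [IncidenceAlgebra.sum_apply, hF, coeff_mul, coeff_toSeries, Finset.mul_sum]
  rw [Finset.sum_comm]
  simp only [Finset.sum_comm (s := Finset.Icc i l)]

/-- At the `(i, m)` entry both sides are sums over `i ≤ j ≤ l ≤ m`, and they agree term by term by
the cocycle identity. -/
lemma formalExtend₂_assoc {F : ℕ → IncidenceAlgebra k P →ₗ[k] IncidenceAlgebra k P →ₗ[k]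
      IncidenceAlgebra k P} {w : P → P → P → k⟦X⟧}
    (hF : ∀ n a b i l, F n a b i l =
      ∑ j ∈ Finset.Icc i l, coeff n (w i j l) * (a i j * b j l)) (hw : IsCocycleFun w)
    (x y z : (IncidenceAlgebra k P)⟦X⟧) :
    formalExtend₂ F (formalExtend₂ F x y) z = formalExtend₂ F x (formalExtend₂ F y z) := by
  obtain ⟨x, rfl⟩ := (toSeries (k := k) (P := P)).surjective x
  obtain ⟨y, rfl⟩ := (toSeries (k := k) (P := P)).surjective y
  obtain ⟨z, rfl⟩ := (toSeries (k := k) (P := P)).surjective z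
  apply (toSeries (k := k) (P := P)).symm.injective
  have e : ∀ x y : IncidenceAlgebra k⟦X⟧ P, formalExtend₂ F (toSeries x) (toSeries y) =
      toSeries (toSeries.symm (formalExtend₂ F (toSeries x) (toSeries y))) := fun x y => by
    rw [AddEquiv.apply_symm_apply]
  rw [e x y, e y z]
  ext1 i m _
  rw [toSeries_symm_formalExtend₂ hF, toSeries_symm_formalExtend₂ hF]
  simp only [toSeries_symm_formalExtend₂ hF, Finset.mul_sum, Finset.sum_mul, Finset.sum_sigma']
  apply Finset.sum_nbij' (fun ⟨a, b⟩ ↦ ⟨b, a⟩) (fun ⟨a, b⟩ ↦ ⟨b, a⟩)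
  · rintro ⟨l, j⟩ h
    simp only [Finset.mem_sigma, Finset.mem_Icc] at h ⊢
    exact ⟨⟨h.2.1, h.2.2.trans h.1.2⟩, h.2.2, h.1.2⟩
  · rintro ⟨j, l⟩ h
    simp only [Finset.mem_sigma, Finset.mem_Icc] at h ⊢
    exact ⟨⟨h.1.1.trans h.2.1, h.2.2⟩, h.1.1, h.2.1⟩
  · rintro ⟨l, j⟩ _
    rfl
  · rintro ⟨j, l⟩ _
    rfl
  · rintro ⟨l, j⟩ h
    simp only [Finset.mem_sigma, Finset.mem_Icc] at h ⊢
    linear_combination (x i j * y j l * z l m) * hw h.2.1 h.2.2 h.1.2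

/-- A normalized cocycle gives a formal deformation. -/
lemma exists_deformation {w : P → P → P → k⟦X⟧}
    (h1 : ∀ i j l, i ≤ j → j ≤ l → constantCoeff (w i j l) = 1) (hw : IsCocycleFun w)
    (hl : ∀ i l, i ≤ l → w i i l = 1) (hr : ∀ i l, i ≤ l → w i l l = 1) :
    ∃ F : FormalDeformation k (IncidenceAlgebra k P), ∀ n a b i l, F.term n a b i l =
      ∑ j ∈ Finset.Icc i l, coeff n (w i j l) * (a i j * b j l) := by
  refine ⟨⟨fun n => twistedMul fun i j l => coeff n (w i j l), fun a b => ?_,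
    formalExtend₂_assoc (fun _ _ _ _ _ => rfl) hw, fun a => ?_, fun a => ?_⟩,
    fun _ _ _ _ _ => rfl⟩
  · ext i l _
    rw [twistedMul_apply, mul_apply]
    refine Finset.sum_congr rfl fun j hj => ?_
    rw [Finset.mem_Icc] at hj
    rw [coeff_zero_eq_constantCoeff_apply, h1 i j l hj.1 hj.2, one_mul]
  · ext n i l hil
    rw [coeff_formalExtend₂_C, twistedMul_apply, Finset.sum_eq_single i, hl i l hil]
    · by_cases hn : n = 0 <;> simp [hn, coeff_C, coeff_one]
    · intro j _ hj
      simp [hj.symm]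
    · simp [hil]
  · ext n i l hil
    rw [coeff_formalExtend₂_C, twistedMul_apply, Finset.sum_eq_single l, hr i l hil]
    · by_cases hn : n = 0 <;> simp [hn, coeff_C, coeff_one]
    · intro j _ hj
      simp [hj]
    · simp [hil]

namespace FormalDeformation

variable {F F' : FormalDeformation k (IncidenceAlgebra k P)}

lemma isGivenBy_iff {ω : PosetCochain P (BigWittGroup k) 2} {w : P → P → P → k⟦X⟧}
    (h : HasValues ω w) : F.IsGivenBy ω ↔ ∀ n a b i l, F.term n a b i l =
      ∑ j ∈ Finset.Icc i l, coeff n (w i j l) * (a i j * b j l) := by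
  have e : ∀ n (a b : IncidenceAlgebra k P) i l, ∑ j : Finset.Icc i l,
      coeff n ((ω (simplex₂ (Finset.mem_Icc.1 j.2).1 (Finset.mem_Icc.1 j.2).2) : k⟦X⟧ˣ) : k⟦X⟧) *
        (a i j * b j l) = ∑ j ∈ Finset.Icc i l, coeff n (w i j l) * (a i j * b j l) := by
    intro n a b i l
    rw [← Finset.sum_coe_sort (Finset.Icc i l)]
    refine Finset.sum_congr rfl fun j _ => ?_
    rw [h]
  simp only [IsGivenBy, e]

/-- The product of the deformed algebra is given by the function `w` on triples `i ≤ j ≤ l`. -/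
def IsGivenByFun (F : FormalDeformation k (IncidenceAlgebra k P)) (w : P → P → P → k⟦X⟧) : Prop :=
  ∀ (x y : F.Alg) (i l : P), F.entries (x * y) i l =
    ∑ j ∈ Finset.Icc i l, w i j l * (F.entries x i j * F.entries y j l)

lemma IsGivenBy.isGivenByFun {ω : PosetCochain P (BigWittGroup k) 2} {w : P → P → P → k⟦X⟧}
    (hF : F.IsGivenBy ω) (h : HasValues ω w) : F.IsGivenByFun w :=
  toSeries_symm_formalExtend₂ ((isGivenBy_iff h).1 hF)

/-- The equivalence is the rescaling `E^{ij} ↦ φ(i,j) E^{ij}`; the relation `hφ` is its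
multiplicativity on matrix units. -/
lemma IsGivenByFun.equivalent {w w' : P → P → P → k⟦X⟧} (hF : F.IsGivenByFun w)
    (hF' : F'.IsGivenByFun w') {φ : P → P → k⟦X⟧} (h1 : ∀ i j, i ≤ j → constantCoeff (φ i j) = 1)
    (hφ : ∀ i j l, i ≤ j → j ≤ l → w' i j l * φ i l = w i j l * (φ i j * φ j l)) :
    F.Equivalent F' := by
  let f : F'.Alg →ₗ[k⟦X⟧] F.Alg :=
    { toFun := fun x => F.model.ofEntries fun i j => φ i j * F'.entries x i j
      map_add' := fun x y => F.model.ext_entries fun i j hij => by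
        rw [F.model.entries_add]
        simp only [F.model.entries_ofEntries _ hij, map_add, IncidenceAlgebra.add_apply, mul_add]
      map_smul' := fun c x => F.model.ext_entries fun i j hij => by
        rw [F.model.entries_smul]
        simp only [F.model.entries_ofEntries _ hij, map_smul, constSMul_apply, smul_eq_mul,
          RingHom.id_apply]
        ring }
  have hf : ∀ x i j, F.entries (f x) i j = φ i j * F'.entries x i j := fun x i j => by
    by_cases hij : i ≤ j
    · exact F.model.entries_ofEntries _ hij
    · rw [apply_eq_zero_of_not_le hij, apply_eq_zero_of_not_le hij, mul_zero]
  refine equivalent_of_linearMap f (fun x y => ?_) fun x => ?_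
  · apply F.model.ext_entries
    intro i l hil
    change F.entries _ i l = F.entries _ i l
    rw [hf, hF, hF', Finset.mul_sum]
    refine Finset.sum_congr rfl fun j hj => ?_
    rw [Finset.mem_Icc] at hj
    rw [hf, hf]
    linear_combination (F'.entries x i j * F'.entries y j l) * hφ i j l hj.1 hj.2
  · ext i j hij
    rw [F.model.red_apply, F'.model.red_apply]
    change constantCoeff (F.entries _ i j) = constantCoeff (F'.entries _ i j)
    rw [hf, map_mul, h1 i j hij, one_mul]

/-- The matrix unit `E^{ij}` in the deformed algebra. -/
noncomputable def matUnit (F : FormalDeformation k (IncidenceAlgebra k P)) (i j : P) : F.Alg :=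
  F.entries.symm (single k⟦X⟧ i j)

lemma entries_matUnit (i j a b : P) :
    F.entries (F.matUnit i j) a b = single k⟦X⟧ i j a b := by
  rw [matUnit, LinearEquiv.apply_symm_apply]

lemma red_matUnit {i j : P} (h : i ≤ j) : F.model.red (F.matUnit i j) = single k i j := by
  ext a b _
  rw [F.model.red_apply]
  change constantCoeff (F.entries _ a b) = _
  rw [entries_matUnit, single_apply_of_le h, single_apply_of_le h]
  split_ifs <;> simp

lemma IsGivenByFun.matUnit_mul {w : P → P → P → k⟦X⟧} (hF : F.IsGivenByFun w) {i j l : P}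
    (hij : i ≤ j) (hjl : j ≤ l) : F.matUnit i j * F.matUnit j l = w i j l • F.matUnit i l := by
  apply F.entries.injective
  ext1 a b _
  rw [hF, map_smul, constSMul_apply, smul_eq_mul]
  simp only [entries_matUnit, single_apply_of_le hij, single_apply_of_le hjl,
    single_apply_of_le (hij.trans hjl)]
  by_cases h : a = i ∧ b = l
  · obtain ⟨rfl, rfl⟩ := h
    rw [Finset.sum_eq_single j] <;> simp_all
  · rw [if_neg h, mul_zero]
    apply Finset.sum_eq_zero
    intro x _
    by_cases h1 : a = i <;> simp_all

lemma IsGivenByFun.matUnit_self_mul {w : P → P → P → k⟦X⟧} (hF : F.IsGivenByFun w)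
    (hl : ∀ i l, i ≤ l → w i i l = 1) (i : P) (x : F.Alg) (a b : P) :
    F.entries (F.matUnit i i * x) a b = if a = i then F.entries x i b else 0 := by
  by_cases hab : a ≤ b
  · rw [hF]
    simp only [entries_matUnit, single_apply_of_le le_rfl]
    split_ifs with h
    · subst h
      rw [Finset.sum_eq_single a] <;> simp_all
    · simp [h]
  · rw [apply_eq_zero_of_not_le hab]
    split_ifs with h
    · rw [apply_eq_zero_of_not_le (h ▸ hab)]
    · rfl

/-- The unit of the deformed algebra is still the identity matrix, so multiplying it with `E^{il}`
on either side reads off the degenerate values of `w`. -/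
lemma IsGivenByFun.normalized {w : P → P → P → k⟦X⟧} (hF : F.IsGivenByFun w) :
    (∀ i l, i ≤ l → w i i l = 1) ∧ ∀ i l, i ≤ l → w i l l = 1 := by
  have hone : F.entries 1 = 1 := by
    ext i j _ n
    rw [← coeff_series, series_one, one_apply, coeff_C]
    by_cases hn : n = 0 <;> by_cases hij : i = j <;> simp [hn, hij, coeff_one]
  constructor
  · intro i l hil
    have := hF 1 (F.matUnit i l) i l
    rw [one_mul, hone, entries_matUnit, single_apply_self hil, Finset.sum_eq_single i] at this
    · rw [entries_matUnit, single_apply_self hil] at this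
      simpa using this.symm
    · intro j _ hj
      simp [hj.symm]
    · simp [hil]
  · intro i l hil
    have := hF (F.matUnit i l) 1 i l
    rw [mul_one, hone, entries_matUnit, single_apply_self hil, Finset.sum_eq_single l] at this
    · rw [entries_matUnit, single_apply_self hil] at this
      simpa using this.symm
    · intro j _ hj
      simp [hj]
    · simp [hil]

lemma IsGivenByFun.matUnit_self_mul_self {w : P → P → P → k⟦X⟧} (hF : F.IsGivenByFun w) (i j : P) :
    F.matUnit i i * F.matUnit j j = if i = j then F.matUnit i i else 0 := by
  apply F.entries.injective
  ext1 a b _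
  rw [hF.matUnit_self_mul hF.normalized.1, entries_matUnit, single_apply_of_le le_rfl]
  by_cases hij : i = j
  · subst hij
    rw [if_pos rfl, entries_matUnit, single_apply_of_le le_rfl]
    by_cases h : a = i <;> simp [h]
  · rw [if_neg hij, map_zero, IncidenceAlgebra.zero_apply]
    simp [hij]

/-- Equivalent deformations are given by cohomologous functions. -/
lemma IsGivenByFun.cohomologous {w w' : P → P → P → k⟦X⟧} (hF : F.IsGivenByFun w)
    (hF' : F'.IsGivenByFun w') (h : F.Equivalent F') :
    ∃ φ : P → P → k⟦X⟧, (∀ i j, i ≤ j → constantCoeff (φ i j) = 1) ∧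
      ∀ i j l, i ≤ j → j ≤ l → w' i j l * φ i l = w i j l * (φ i j * φ j l) := by
  obtain ⟨f, hmul, hred⟩ := h.exists_linearMap
  obtain ⟨hl, hr⟩ := hF.normalized
  obtain ⟨hl', hr'⟩ := hF'.normalized
  -- Two systems of matrix units in the same algebra, with structure constants `w` and `w'` and
  -- equal reductions modulo `λ`.
  let E : P → P → F.Alg := F.matUnit
  let V : P → P → F.Alg := fun i j => f (F'.matUnit i j)
  have hE : ∀ {i j l}, i ≤ j → j ≤ l → E i j * E j l = w i j l • E i l := hF.matUnit_mul
  have hV : ∀ {i j l}, i ≤ j → j ≤ l → V i j * V j l = w' i j l • V i l := fun hij hjl => by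
    rw [← hmul, hF'.matUnit_mul hij hjl, map_smul]
  have hEE : ∀ i j, E i i * E j j = if i = j then E i i else 0 := hF.matUnit_self_mul_self
  have hVV : ∀ i j, V i i * V j j = if i = j then V i i else 0 := fun i j => by
    rw [← hmul, hF'.matUnit_self_mul_self]
    split_ifs
    · rfl
    · exact map_zero f
  have hE1 : ∀ {i j}, i ≤ j → E i i * E i j = E i j := fun hij => by
    rw [hE le_rfl hij, hl _ _ hij, one_smul]
  have hE2 : ∀ {i j}, i ≤ j → E i j * E j j = E i j := fun hij => by
    rw [hE hij le_rfl, hr _ _ hij, one_smul]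
  have hV1 : ∀ {i j}, i ≤ j → V i i * V i j = V i j := fun hij => by
    rw [hV le_rfl hij, hl' _ _ hij, one_smul]
  have hV2 : ∀ {i j}, i ≤ j → V i j * V j j = V i j := fun hij => by
    rw [hV hij le_rfl, hr' _ _ hij, one_smul]
  have hEred : ∀ {i j}, i ≤ j → F.model.red (E i j) = single k i j := red_matUnit
  have hVred : ∀ {i j}, i ≤ j → F.model.red (V i j) = single k i j := fun hij => by
    rw [hred, red_matUnit hij]
  -- `u` intertwines the two systems of idempotents
  obtain ⟨u, hu⟩ : ∃ u : F.Alg, ∀ i, E i i * u = E i i * V i i := by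
    refine ⟨F.model.ofEntries fun i j => F.entries (V i i) i j, fun i => ?_⟩
    apply F.model.ext_entries
    intro a b hab
    change F.entries _ a b = F.entries _ a b
    rw [hF.matUnit_self_mul hl, hF.matUnit_self_mul hl]
    split_ifs with hai
    · subst hai
      exact F.model.entries_ofEntries _ hab
    · rfl
  have hext : ∀ x y : F.Alg, (∀ i, E i i * x = E i i * y) → x = y := by
    intro x y hxy
    apply F.entries.injective
    ext1 a b _
    have := congrArg (fun x => F.entries x a b) (hxy a)
    simp only [E, hF.matUnit_self_mul hl, if_true] at this
    exact this
  have huV : ∀ i, u * V i i = E i i * u := by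
    intro i
    apply hext
    intro j
    rw [← mul_assoc, hu, mul_assoc, hVV, ← mul_assoc, hEE]
    split_ifs
    · rw [hu]
    · rw [mul_zero, zero_mul]
  have hured : F.model.red u = 1 := by
    ext a b _
    have := congrArg (fun x => F.model.red x a b) (hu a)
    simp only [map_mul, hEred le_rfl, hVred le_rfl, single_self_mul_apply, if_true] at this
    rw [this, single_apply_of_le le_rfl, one_apply]
    simp [eq_comm]
  have hlead : ∀ {i j}, i ≤ j → constantCoeff (F.model.entries (E i j * u) i j) = 1 := fun hij => by
    rw [← F.model.red_apply, map_mul, hured, mul_one, hEred hij, single_apply_self hij]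
  have hlead0 : ∀ {i j}, i ≤ j → constantCoeff (F.model.entries (E i j * u) i j) ≠ 0 :=
    fun hij => by
      rw [hlead hij]
      exact one_ne_zero
  -- Both elements are fixed by `E_{ii}` on the left and by `V_{jj}` on the right, so each is
  -- determined by its `(i, j)` entry, whose constant term is `1`.
  have huV' : ∀ i j, i ≤ j → ∃ c : k⟦X⟧, constantCoeff c = 1 ∧ u * V i j = c • (E i j * u) := by
    intro i j hij
    refine ⟨F.model.entries (u * V i j) i j * (F.model.entries (E i j * u) i j)⁻¹, ?_, ?_⟩
    · rw [map_mul, constantCoeff_inv, hlead hij, ← F.model.red_apply, map_mul, hured, one_mul,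
        hVred hij, single_apply_self hij, inv_one, one_mul]
    · refine F.model.eq_of_entry (hEred (le_refl i)) (hVred (le_refl j)) ?_ ?_ ?_ ?_ ?_
      · rw [← mul_assoc, ← huV, mul_assoc, hV1 hij]
      · rw [mul_assoc, hV2 hij]
      · rw [mul_smul_comm, ← mul_assoc, hE1 hij]
      · rw [smul_mul_assoc, mul_assoc, huV, ← mul_assoc, hE2 hij]
      · rw [F.model.entries_smul, mul_assoc, PowerSeries.inv_mul_cancel _ (hlead0 hij), mul_one]
  choose! φ hφ1 hφ using huV'
  refine ⟨φ, hφ1, fun i j l hij hjl => ?_⟩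
  have hil := hij.trans hjl
  -- Evaluate `u V_{ij} V_{jl}` in two ways: multiply the `V`s first, or move `u` past them one at a
  -- time.
  have key : (w' i j l * φ i l) • (E i l * u) = (w i j l * (φ i j * φ j l)) • (E i l * u) := by
    rw [mul_smul, ← hφ i l hil, ← mul_smul_comm, ← hV hij hjl, ← mul_assoc, hφ i j hij,
      smul_mul_assoc, mul_assoc, hφ j l hjl, mul_smul_comm, ← mul_assoc, hE hij hjl,
      smul_mul_assoc, smul_smul, smul_smul]
    congr 1
    ring
  have := congrArg (fun x => F.model.entries x i l) key
  simp only [F.model.entries_smul] at this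
  refine mul_right_cancel₀ (fun h0 => hlead0 hil ?_) this
  rw [h0, map_zero]

/-- Every deformation is equivalent to one given by a cocycle. -/
lemma exists_equivalent_isGivenBy (F : FormalDeformation k (IncidenceAlgebra k P)) :
    ∃ (ω : PosetZ2 P (BigWittGroup k)) (F' : FormalDeformation k (IncidenceAlgebra k P)),
      F'.IsGivenBy ω.1 ∧ F'.Equivalent F := by
  obtain ⟨S⟩ := F.model.nonempty_frame
  have h1 : ∀ i j l, i ≤ j → j ≤ l → constantCoeff (S.cocycle i j l) = 1 :=
    fun i j l => S.constantCoeff_cocycle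
  have hc : IsCocycleFun S.cocycle := fun i j l m => S.cocycle_mul
  obtain ⟨ω, hω⟩ := exists_Z2_of_isCocycleFun h1 hc
  obtain ⟨F', hF'⟩ := exists_deformation h1 hc (fun i l => S.cocycle_left)
    (fun i l => S.cocycle_right)
  have hgiven := (isGivenBy_iff hω).2 hF'
  refine ⟨ω, F', hgiven, ?_⟩
  have hentries : ∀ x : F.Alg, F'.entries ((F.entries.trans F'.entries.symm) (S.coord x)) =
      F.entries (S.coord x) := fun x => by simp
  -- The equivalence is the coordinate map of the frame, its values being read as elements of the
  -- algebra given by the cocycle.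
  refine equivalent_of_linearMap ((F.entries.trans F'.entries.symm).toLinearMap ∘ₗ S.coord)
    (fun x y => ?_) fun x => ?_
  · apply F'.entries.injective
    ext1 i l _
    rw [hgiven.isGivenByFun hω]
    simp only [LinearMap.comp_apply, LinearEquiv.coe_coe, hentries]
    exact S.entries_coord_mul x y i l
  · rw [← S.red_coord]
    rfl

end FormalDeformation
end Cocycle

/-! ### The classification. -/

theorem mainTheorem8 {k : Type*} [Field k] [CharZero k]
    {P : Type*} [PartialOrder P] [LocallyFiniteOrder P] [DecidableEq P] :
    (∀ c : PosetH2 P (BigWittGroup k), ∃ ω : PosetZ2 P (BigWittGroup k),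
      (QuotientGroup.mk ω : PosetH2 P (BigWittGroup k)) = c ∧
        ∃ F : FormalDeformation k (IncidenceAlgebra k P), F.IsGivenBy ω.1) ∧
    ∃! Ψ : PosetH2 P (BigWittGroup k) ≃ DeformationClasses k (IncidenceAlgebra k P),
      ∀ (ω : PosetZ2 P (BigWittGroup k)) (F : FormalDeformation k (IncidenceAlgebra k P)),
        F.IsGivenBy ω.1 → Ψ (QuotientGroup.mk ω) = F.toClass := by
  have hex : ∀ c : PosetH2 P (BigWittGroup k), ∃ ω : PosetZ2 P (BigWittGroup k),
      (QuotientGroup.mk ω : PosetH2 P (BigWittGroup k)) = c ∧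
        ∃ F : FormalDeformation k (IncidenceAlgebra k P), F.IsGivenBy ω.1 := by
    intro c
    obtain ⟨ω, w, hc, hω, hl, hr⟩ := exists_normalized c
    obtain ⟨F, hF⟩ := exists_deformation (fun i j l => hω.constantCoeff) (hω.mem_Z2_iff.1 ω.2) hl hr
    exact ⟨ω, hc, F, (FormalDeformation.isGivenBy_iff hω).2 hF⟩
  -- This yields at once that the class of `F` does not depend on the chosen representative cocycle
  -- or deformation, and that the map is injective.
  have hiff : ∀ (ω ω' : PosetZ2 P (BigWittGroup k))
      (F F' : FormalDeformation k (IncidenceAlgebra k P)), F.IsGivenBy ω.1 → F'.IsGivenBy ω'.1 →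
      ((QuotientGroup.mk ω : PosetH2 P (BigWittGroup k)) = QuotientGroup.mk ω' ↔
        F.toClass = F'.toClass) := by
    intro ω ω' F F' hF hF'
    obtain ⟨w, hω⟩ := exists_hasValues ω.1
    obtain ⟨w', hω'⟩ := exists_hasValues ω'.1
    rw [mk_eq_mk_iff hω hω']
    have hq : F.toClass = F'.toClass ↔ F.Equivalent F' := Quotient.eq
    rw [hq]
    exact ⟨fun ⟨φ, h1, hφ⟩ => (hF.isGivenByFun hω).equivalent (hF'.isGivenByFun hω') h1 hφ,
      (hF.isGivenByFun hω).cohomologous (hF'.isGivenByFun hω')⟩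
  refine ⟨hex, ?_⟩
  choose ω hω F hF using hex
  have hbij : Function.Bijective fun c => (F c).toClass := by
    constructor
    · intro c d hcd
      rw [← hω c, ← hω d]
      exact (hiff _ _ _ _ (hF c) (hF d)).2 hcd
    · intro D
      obtain ⟨G, rfl⟩ := Quotient.exists_rep D
      obtain ⟨ω', G', hG', hequiv⟩ := G.exists_equivalent_isGivenBy
      refine ⟨QuotientGroup.mk ω', ?_⟩
      have h1 : (F (QuotientGroup.mk ω')).toClass = G'.toClass :=
        (hiff _ _ _ _ (hF _) hG').1 (hω _)
      exact h1.trans (Quotient.sound hequiv)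
  refine ⟨Equiv.ofBijective _ hbij, fun ω' G hG => (hiff _ _ _ _ (hF _) hG).1 (hω _), ?_⟩
  -- Uniqueness: every class contains a cocycle that gives a deformation, so the required property
  -- fixes all values of `Ψ`.
  intro Ψ hΨ
  ext c
  rw [← hω c, hΨ _ _ (hF c)]
  exact ((hiff _ _ _ _ (hF _) (hF c)).1 (hω _)).symm
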